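/- **Setting.** Let $X=X_{free}\subset\mathbb{R}^2$ be a free space without pinch points: every $x\in X$ has arbitrarily small neighbourhoods $V$ such that $(V\cap X)\setminus\{x\}$ is connected or empty. Let $(C_i)_{i\in I}$, $I$ finite, be a convex dissection of $X$: each $C_i$ is a convex polygon (the convex hull of finitely many points, with non-empty interior), different cells have disjoint interiors, $\bigcup_i C_i=X$, and whenever two different cells meet in more than one point, so that $C_i\cap C_j$ is a non-degenerate segment (a *cutline*), both endpoints of that segment lie on the boundary of $X$. ($X$ may have holes and several components.) The *topology graph* $X_{topo}$ has node set $I$; two different nodes are adjacent iff their cells share a cutline. A path in $X_{topo}$ from $a$ to $b$ is a finite sequence of nodes with first element $a$ and last element $b$ whose consecutive elements are adjacent or equal. Two such paths are *homotopic*, $\mathrm f\simeq_p\mathrm g$, if one is obtained from the other by finitely many moves, each of which replaces an element $x$ by $(x,x)$ or $(x,y,x)$ (extension) or a fragment $(x,x)$ or $(x,y,x)$ by $x$ (contraction), all intermediate sequences being paths from $a$ to $b$. A path is *no-rollback* if it has no fragment $(x,x)$ or $(x,y,x)$. For a path $f:[0,1]\to X$ and nodes $a,b$ with $f(0)\in C_a$,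 $f(1)\in C_b$, let $\Gamma(f)=\Gamma_{a,b}(f)$ be the set of sequences of cells that $f$ passes in order, starting at $a$ and ending at $b$: the paths $(c_1,\dots,c_n)$ in $X_{topo}$ from $a$ to $b$ for which there are times $0=t_0\le t_1\le\dots\le t_n=1$ with $f([t_{k-1},t_k])\subseteq C_{c_k}$ for all $k$. (Different choices are possible only because $f$ may lie in several cells at once.) Let $\Gamma^*(f)$ be the set of no-rollback paths homotopic to an element of $\Gamma(f)$ and, for a homotopy class $q$ of paths in $X$ (endpoints fixed), let $\Gamma^*(q)=\bigcup_{f\in q}\Gamma^*(f)$. **Theorem.** Let $x_0,x_1\in X$, and let $a,b\in I$ with $x_0\in C_a$, $x_1\in C_b$. All paths below run from $x_0$ to $x_1$ in $X$, and $\Gamma,\Gamma^*$ are taken with first node $a$ and last node $b$. 1. If the set of cells containing $f(t)$ changes at only finitely many times $t$, then $\Gamma(f)\neq\emptyset$. 2. For all paths $f,g$ and all $\mathrm u\in\Gamma(f)$, $\mathrm v\in\Gamma(g)$: $f$ and $g$ are path-homotopic in $X$ if and only if $\mathrm u\simeq_p\mathrm v$. 3. If $\Gamma(f)\ne\emptyset$,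 then $\Gamma^*(f)$ has exactly one element. 4. For every homotopy class $q$ of paths from $x_0$ to $x_1$ (including classes represented by paths with $\Gamma(f)=\emptyset$), $\Gamma^*(q)$ has exactly one element. 5. If $\Gamma^*(q)=\Gamma^*(q')$ for two homotopy classes $q,q'$, then $q=q'$. 6. For all paths $f,g$ and all $\mathrm w\in\Gamma^*(f)$, $\mathrm w'\in\Gamma^*(g)$: $f$ and $g$ are path-homotopic in $X$ if and only if $\mathrm w=\mathrm w'$. -/

import Mathlib

open Set Topology

namespace ConvexDissectionTopology

/-- The Euclidean plane. -/
abbrev Plane : Type := EuclideanSpace ℝ (Fin 2)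

/-- A convex polygon: the convex hull of finitely many points, with non-empty interior. -/
def IsConvexPolygon (C : Set Plane) : Prop :=
  (∃ S : Finset Plane, C = convexHull ℝ (S : Set Plane)) ∧ (interior C).Nonempty

/-- `X` has no pinch point (it is not "point-connected" anywhere): every point of `X` has
arbitrarily small neighbourhoods `V` such that `V ∩ X` stays connected when the point is deleted. -/
def NoPinchPoint (X : Set Plane) : Prop :=
  ∀ x ∈ X, ∀ U ∈ 𝓝 x, ∃ V ∈ 𝓝 x, V ⊆ U ∧ IsPreconnected ((V ∩ X) \ {x})

/-- A convex dissection of the planar set `X`, with cells indexed by `ι`: convex polygons that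
overlap only along their boundaries, whose union is `X`, and such that the two endpoints of each
cutline (a non-degenerate segment in which two different cells meet) lie on the boundary of `X`. -/
structure ConvexDissection (X : Set Plane) (ι : Type*) where
  cell : ι → Set Plane
  isConvexPolygon_cell : ∀ i, IsConvexPolygon (cell i)
  disjoint_interior : ∀ i j, i ≠ j → Disjoint (interior (cell i)) (interior (cell j))
  iUnion_cell : ⋃ i, cell i = X
  endpoint_cutline : ∀ i j, i ≠ j → (cell i ∩ cell j).Nontrivial →
    (cell i ∩ cell j).extremePoints ℝ ⊆ frontier X

/-- The topology graph of a dissection: the nodes are the cells, and two different cells are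
adjacent when they share a cutline, that is, when they meet in more than one point. -/
def ConvexDissection.topologyGraph {X : Set Plane} {ι : Type*} (D : ConvexDissection X ι) :
    SimpleGraph ι where
  Adj i j := i ≠ j ∧ (D.cell i ∩ D.cell j).Nontrivial
  symm := ⟨fun i j h => ⟨h.1.symm, by rw [Set.inter_comm]; exact h.2⟩⟩
  loopless := ⟨fun _ h => h.1 rfl⟩

/-- A path in a graph from `a` to `b`: a finite sequence of nodes, each consecutive pair of which
is adjacent or equal (repetitions such as `(x, x)` are allowed). -/
structure TopoPath {V : Type*} (G : SimpleGraph V) (a b : V) where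
  nodes : List V
  isChain : nodes.IsChain (fun x y => x = y ∨ G.Adj x y)
  head_eq : nodes.head? = some a
  last_eq : nodes.getLast? = some b

namespace TopoPath

variable {V : Type*} {G : SimpleGraph V} {a b : V}

/-- `q` arises from `p` by replacing one element `x` with `(x, x)` or with `(x, y, x)`. -/
def Extension (p q : TopoPath G a b) : Prop :=
  ∃ (l r : List V) (x : V), p.nodes = l ++ [x] ++ r ∧
    (q.nodes = l ++ [x, x] ++ r ∨ ∃ y, q.nodes = l ++ [x, y, x] ++ r)

/-- `q` arises from `p` by replacing one fragment `(x, x)` or `(x, y, x)` with `x`. -/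
def Contraction (p q : TopoPath G a b) : Prop := Extension q p

/-- Path homotopy in the graph: a finite sequence of extensions and contractions, all of whose
terms are paths from `a` to `b`, leads from `p` to `q`. -/
def Homotopic (p q : TopoPath G a b) : Prop :=
  Relation.ReflTransGen (fun u v => Extension u v ∨ Contraction u v) p q

/-- A no-rollback path: no fragment `(x, x)` and no fragment `(x, y, x)`, that is, no contraction
applies. -/
def NoRollback (p : TopoPath G a b) : Prop :=
  ∀ (l r : List V) (x : V), p.nodes ≠ l ++ [x, x] ++ r ∧ ∀ y, p.nodes ≠ l ++ [x, y, x] ++ r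

end TopoPath

namespace ConvexDissection

variable {X : Set Plane} {ι : Type*} (D : ConvexDissection X ι) {x₀ x₁ : X}

/-- The cells that contain `f t` change at only finitely many times `t`. -/
def ChangesFinitelyOften (f : Path x₀ x₁) : Prop :=
  ∃ T : Finset unitInterval, ∀ s t : unitInterval, (∀ r ∈ Set.uIcc s t, r ∉ T) →
    ∀ i, (f s : Plane) ∈ D.cell i ↔ (f t : Plane) ∈ D.cell i

/-- `Γ(f)`, with first cell `a` and last cell `b`: the sequences of cells `(c₀, …, cₙ₋₁)` that `f`
passes in order, i.e. for some times `0 = t₀ ≤ t₁ ≤ … ≤ tₙ = 1` the path is in the cell `cₖ` during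
`[tₖ, tₖ₊₁]`. All choices are collected that are possible while `f` lies in several cells. -/
def Gamma (f : Path x₀ x₁) (a b : ι) : Set (TopoPath D.topologyGraph a b) :=
  {u | ∃ t : ℕ → unitInterval, Monotone t ∧ t 0 = 0 ∧ t u.nodes.length = 1 ∧
    ∀ (k : ℕ) (hk : k < u.nodes.length), ∀ s ∈ Set.Icc (t k) (t (k + 1)),
      (f s : Plane) ∈ D.cell u.nodes[k]}

/-- `Γ*(f)`: the no-rollback paths that are homotopic, in the topology graph, to a member
of `Γ(f)`. -/
def GammaStar (f : Path x₀ x₁) (a b : ι) : Set (TopoPath D.topologyGraph a b) :=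
  {w | w.NoRollback ∧ ∃ u ∈ D.Gamma f a b, u.Homotopic w}

/-- The image under `Γ*` of a homotopy class of paths in `X`. -/
def GammaStarClass (q : Path.Homotopic.Quotient x₀ x₁) (a b : ι) :
    Set (TopoPath D.topologyGraph a b) :=
  {w | ∃ f : Path x₀ x₁, Path.Homotopic.Quotient.mk f = q ∧ w ∈ D.GammaStar f a b}

end ConvexDissection

end ConvexDissectionTopology

/-!
Homotopy of paths in a convex dissection is decided in a free group. Send a step from a cell `i` to
a cell `j` to `(i, j) * (j, i)⁻¹` in the free group on pairs of cells, and a sequence of cells to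
the product of its steps, its holonomy. Extensions and contractions do not change the holonomy, and
the word of a no-rollback sequence is reduced and spells out the sequence. So two paths in the
topology graph are homotopic iff their holonomies agree
(`TopoPath.homotopic_iff_holonomy_eq`), and each class has exactly one no-rollback member.

The geometry enters through the cells at a point `x` of `X`. They are connected by adjacency,
because `x` is not a pinch point (`ConvexDissection.reflTransGen_adjAt`). They contain no cycle of
adjacent cells: a convex plane set is bounded near `x` by two edges that issue from `x`, so the
cells of a cycle fill a neighbourhood of `x`; then `x` is interior to `X`, hence not an endpoint
of a cutline, and a cutline with `x` as an inner point separates just two cells, which leave no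
room for a third (`ConvexDissection.exists_leaf`). Without cycles, the steps between the cells at
`x` are the differences of a function on these cells (`ConvexDissection.exists_potential`).

Say that a homotopy class of paths in `X` realizes a sequence of cells if it is a product of
classes inside these cells. By convexity a sequence determines the class that realizes it, given
the endpoints, and extensions and contractions keep that class
(`ConvexDissection.Realizes.unique`, `ConvexDissection.Realizes.of_homotopic`). Conversely, the
local potentials glue to a covering of `X` with the free group as fibre, in which the monodromy of
a class is multiplication by the holonomy of any sequence that it realizes. Therefore the class
determines the holonomy (`ConvexDissection.Realizes.homotopic`).

Subdividing a path, and connecting cells inside the connected set of cells at a point, shows that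
every class realizes some sequence (`ConvexDissection.exists_realizes_mk`), and that `Γ(f)` is not
empty if `f` changes cells finitely often.
-/

namespace ConvexDissectionTopology

/-! ### Holonomy of node sequences in a free group -/

section Holonomy

variable {V : Type*}

/-- The letter pair attached to a step from `i` to `j`. It is chosen such that the inverse step has
the inverse value and a stationary step has value `1`, with no orientation of the edges needed. -/
def step (i j : V) : FreeGroup (V × V) := FreeGroup.of (i, j) * (FreeGroup.of (j, i))⁻¹

@[simp] lemma step_self (i : V) : step i i = 1 := by simp [step]

@[simp] lemma step_mul_step_swap (i j : V) : step i j * step j i = 1 := by simp [step]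

/-- The product of the steps along a sequence of nodes. -/
def holonomy : List V → FreeGroup (V × V)
  | [] => 1
  | [_] => 1
  | i :: j :: L => step i j * holonomy (j :: L)

lemma holonomy_append_cons (l r : List V) (x : V) :
    holonomy (l ++ x :: r) = holonomy (l ++ [x]) * holonomy (x :: r) := by
  induction l with
  | nil => simp [holonomy]
  | cons i l ih =>
    cases l with
    | nil => simp [holonomy]
    | cons j l => simpa [holonomy, mul_assoc] using ih

/-- The letters of the steps along a sequence of nodes. -/
def stepWord : List V → List ((V × V) × Bool)
  | [] => []
  | [_] => []
  | i :: j :: L => ((i, j), true) :: ((j, i), false) :: stepWord (j :: L)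

lemma holonomy_eq_mk_stepWord : ∀ L : List V, holonomy L = FreeGroup.mk (stepWord L)
  | [] => rfl
  | [_] => rfl
  | i :: j :: L => by
    rw [holonomy, holonomy_eq_mk_stepWord (j :: L), step, FreeGroup.of, FreeGroup.of,
      FreeGroup.inv_mk, FreeGroup.mul_mk, FreeGroup.mul_mk]
    simp [FreeGroup.invRev, stepWord]

lemma eq_of_stepWord_eq (i : V) : ∀ L L' : List V, stepWord (i :: L) = stepWord (i :: L') → L = L'
  | [], [] => fun _ => rfl
  | [], _ :: _ => fun h => by simp [stepWord] at h
  | _ :: _, [] => fun h => by simp [stepWord] at h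
  | j :: L, k :: L' => fun h => by
    simp only [stepWord, List.cons.injEq, Prod.mk.injEq, and_true, true_and] at h
    obtain ⟨rfl, -, h⟩ := h
    rw [eq_of_stepWord_eq j L L' h]

/-- The letters along a sequence without fragments `(x, x)` and `(x, y, x)` do not cancel. -/
lemma isReduced_stepWord : ∀ L : List V,
    (∀ (l r : List V) (x : V), L ≠ l ++ [x, x] ++ r ∧ ∀ y, L ≠ l ++ [x, y, x] ++ r) →
    FreeGroup.IsReduced (stepWord L)
  | [], _ => by simp [stepWord]
  | [_], _ => by simp [stepWord]
  | [i, j], h => by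
    have hij : i ≠ j := fun e => (h [] [] i).1 (by simp [e])
    simp only [stepWord, FreeGroup.isReduced_cons_cons, FreeGroup.IsReduced.singleton, and_true]
    simp [hij]
  | i :: j :: k :: L, h => by
    have hij : i ≠ j := fun e => (h [] (k :: L) i).1 (by simp [e])
    have hik : i ≠ k := fun e => (h [] L i).2 j (by simp [e])
    have ih := isReduced_stepWord (j :: k :: L) fun l r x =>
      ⟨fun e => (h (i :: l) r x).1 (by simp [e]), fun y e => (h (i :: l) r x).2 y (by simp [e])⟩
    simp only [stepWord, FreeGroup.isReduced_cons_cons] at ih ⊢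
    exact ⟨by simp [hij], by simp [hik], ih⟩

lemma eq_of_isReduced_of_mk_eq {α : Type*} {w w' : List (α × Bool)} (hw : FreeGroup.IsReduced w)
    (hw' : FreeGroup.IsReduced w') (h : FreeGroup.mk w = FreeGroup.mk w') : w = w' := by
  obtain ⟨c, hc, hc'⟩ := FreeGroup.Red.exact.1 h
  rw [← hw.red_iff_eq.1 hc, hw'.red_iff_eq.1 hc']

end Holonomy

/-! ### Homotopy of paths in a graph -/

namespace TopoPath

section Graph

variable {V : Type*} {G : SimpleGraph V} {a b c : V}

lemma ext_nodes {p q : TopoPath G a b} (h : p.nodes = q.nodes) : p = q := by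
  cases p; cases q; simpa using h

lemma exists_nodes_eq_cons (p : TopoPath G a b) : ∃ L, p.nodes = a :: L := by
  have := p.head_eq
  cases h : p.nodes with
  | nil => simp [h] at this
  | cons i L => simp [h] at this; exact ⟨L, by rw [this]⟩

lemma nodes_ne_nil (p : TopoPath G a b) : p.nodes ≠ [] := by
  obtain ⟨L, hL⟩ := p.exists_nodes_eq_cons
  simp [hL]

lemma Homotopic.symm {p q : TopoPath G a b} (h : p.Homotopic q) : q.Homotopic p :=
  have : Std.Symm fun u v : TopoPath G a b => Extension u v ∨ Contraction u v :=
    ⟨fun _ _ => Or.symm⟩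
  Relation.ReflTransGen.stdSymm.symm _ _ h

lemma Homotopic.trans {p q r : TopoPath G a b} (h : p.Homotopic q) (h' : q.Homotopic r) :
    p.Homotopic r :=
  Relation.ReflTransGen.trans h h'

lemma Extension.holonomy_eq {p q : TopoPath G a b} (h : Extension p q) :
    holonomy p.nodes = holonomy q.nodes := by
  obtain ⟨l, r, x, hp, hq | ⟨y, hq⟩⟩ := h <;>
  · simp only [hp, hq, List.append_assoc, List.cons_append, List.nil_append]
    rw [holonomy_append_cons l r, holonomy_append_cons l (_ :: _)]
    simp [holonomy, ← mul_assoc]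

lemma Homotopic.holonomy_eq {p q : TopoPath G a b} (h : p.Homotopic q) :
    holonomy p.nodes = holonomy q.nodes := by
  induction h with
  | refl => rfl
  | tail _ h ih => exact ih.trans (h.elim (·.holonomy_eq) (·.holonomy_eq.symm))

/-- Contracting until no fragment `(x, x)` or `(x, y, x)` is left terminates. -/
lemma exists_noRollback_homotopic (p : TopoPath G a b) :
    ∃ w : TopoPath G a b, w.NoRollback ∧ p.Homotopic w := by
  induction hn : p.nodes.length using Nat.strong_induction_on generalizing p with
  | _ n ih =>
    by_cases hp : p.NoRollback
    · exact ⟨p, hp, .refl⟩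
    have key : ∃ (l r m : List V) (x : V), p.nodes = l ++ x :: (m ++ x :: r) ∧
        (m = [] ∨ ∃ y, m = [y]) := by
      unfold NoRollback at hp
      push Not at hp
      obtain ⟨l, r, x, h⟩ := hp
      by_cases h1 : p.nodes = l ++ [x, x] ++ r
      · exact ⟨l, r, [], x, by simp [h1], .inl rfl⟩
      · obtain ⟨y, hy⟩ := h h1
        exact ⟨l, r, [y], x, by simp [hy], .inr ⟨y, rfl⟩⟩
    obtain ⟨l, r, m, x, hx, hm⟩ := key
    let q : TopoPath G a b :=
      { nodes := l ++ x :: r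
        isChain := by
          have h := p.isChain
          rw [hx, List.isChain_split] at h
          have h' := h.2
          rw [← List.cons_append, List.isChain_split] at h'
          exact List.isChain_split.2 ⟨h.1, h'.2⟩
        head_eq := by
          have h := p.head_eq
          rw [hx] at h
          cases l <;> simpa using h
        last_eq := by
          have h := p.last_eq
          rw [hx] at h
          simpa [List.getLast?_append, List.getLast?_cons] using h }
    have hpq : p.Homotopic q := by
      refine .single (.inr ⟨l, r, x, by simp [q], ?_⟩)
      rcases hm with rfl | ⟨y, rfl⟩
      · left; simp [hx]
      · right; exact ⟨y, by simp [hx]⟩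
    obtain ⟨w, hw, hqw⟩ := ih q.nodes.length (by rw [← hn, hx]; simp [q]) q rfl
    exact ⟨w, hw, hpq.trans hqw⟩

/-- The holonomy of a no-rollback path is a reduced word, which spells out the path. -/
lemma NoRollback.eq_of_holonomy_eq {p q : TopoPath G a b} (hp : p.NoRollback) (hq : q.NoRollback)
    (h : holonomy p.nodes = holonomy q.nodes) : p = q := by
  rw [holonomy_eq_mk_stepWord, holonomy_eq_mk_stepWord] at h
  have hw := eq_of_isReduced_of_mk_eq (isReduced_stepWord _ hp) (isReduced_stepWord _ hq) h
  obtain ⟨L, hL⟩ := p.exists_nodes_eq_cons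
  obtain ⟨L', hL'⟩ := q.exists_nodes_eq_cons
  rw [hL, hL'] at hw
  exact ext_nodes (by rw [hL, hL', eq_of_stepWord_eq a L L' hw])

theorem homotopic_iff_holonomy_eq {p q : TopoPath G a b} :
    p.Homotopic q ↔ holonomy p.nodes = holonomy q.nodes := by
  refine ⟨Homotopic.holonomy_eq, fun h => ?_⟩
  obtain ⟨v, hv, hpv⟩ := p.exists_noRollback_homotopic
  obtain ⟨w, hw, hqw⟩ := q.exists_noRollback_homotopic
  have := hv.eq_of_holonomy_eq hw (by rw [← hpv.holonomy_eq, h, hqw.holonomy_eq])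
  exact hpv.trans (this ▸ hqw.symm)

lemma NoRollback.eq_of_homotopic {p q : TopoPath G a b} (hp : p.NoRollback) (hq : q.NoRollback)
    (h : p.Homotopic q) : p = q :=
  hp.eq_of_holonomy_eq hq h.holonomy_eq

/-- Two paths in sequence; the node in the middle is listed twice. -/
def append (p : TopoPath G a b) (q : TopoPath G b c) : TopoPath G a c where
  nodes := p.nodes ++ q.nodes
  isChain := by
    refine List.isChain_append.2 ⟨p.isChain, q.isChain, fun x hx y hy => .inl ?_⟩
    rw [p.last_eq] at hx
    rw [q.head_eq] at hy
    simp_all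
  head_eq := by rw [List.head?_append, p.head_eq]; rfl
  last_eq := by rw [List.getLast?_append, q.last_eq]; rfl

/-- The path that consists of one node. -/
def single (a : V) : TopoPath G a a := ⟨[a], by simp, rfl, rfl⟩

/-- The path along one edge. -/
def edge (h : G.Adj a b) : TopoPath G a b := ⟨[a, b], by simp [h], rfl, rfl⟩

end Graph

end TopoPath

/-! ### Plane convex geometry -/

section Plane

/-- The determinant of two plane vectors. -/
def cross (u v : Plane) : ℝ := u 0 * v 1 - u 1 * v 0

lemma cross_smul_eq (u v p : Plane) : cross u v • p = cross p v • u + cross u p • v := by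
  ext i
  fin_cases i <;> simp [cross] <;> ring

@[simp] lemma cross_self (u : Plane) : cross u u = 0 := by simp [cross, mul_comm]

@[simp] lemma cross_zero_right (u : Plane) : cross u 0 = 0 := by simp [cross]

@[simp] lemma cross_zero_left (u : Plane) : cross 0 u = 0 := by simp [cross]

lemma cross_swap (u v : Plane) : cross v u = -cross u v := by simp [cross]; ring

@[simp] lemma cross_smul_left (t : ℝ) (u v : Plane) : cross (t • u) v = t * cross u v := by
  simp [cross]; ring

@[simp] lemma cross_smul_right (t : ℝ) (u v : Plane) : cross u (t • v) = t * cross u v := by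
  simp [cross]; ring

lemma cross_add_right (u v w : Plane) : cross u (v + w) = cross u v + cross u w := by
  simp [cross]; ring

@[fun_prop]
lemma continuous_cross {Y : Type*} [TopologicalSpace Y] {f g : Y → Plane} (hf : Continuous f)
    (hg : Continuous g) : Continuous fun y => cross (f y) (g y) := by
  unfold ConvexDissectionTopology.cross
  fun_prop

lemma exists_smul_of_cross_eq_zero {u w : Plane} (hu : u ≠ 0) (h : cross u w = 0) :
    ∃ t : ℝ, w = t • u := by
  have h' : u 0 ^ 2 + u 1 ^ 2 ≠ 0 := by
    intro h0
    have h1 : u 0 = 0 := by nlinarith [sq_nonneg (u 0), sq_nonneg (u 1)]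
    have h2 : u 1 = 0 := by nlinarith [sq_nonneg (u 0), sq_nonneg (u 1)]
    exact hu (by ext i; fin_cases i <;> simp [h1, h2])
  refine ⟨(u 0 * w 0 + u 1 * w 1) / (u 0 ^ 2 + u 1 ^ 2), ?_⟩
  unfold cross at h
  ext i
  fin_cases i
  · simp; field_simp; linear_combination (-u 1) * h
  · simp; field_simp; linear_combination (u 0) * h

variable {A B : Set Plane} {x y z q m p : Plane}

/-- Membership in a triangle in terms of barycentric coordinates. -/
lemma mem_of_cross_div (hA : Convex ℝ A) (hx : x ∈ A) (hy : y ∈ A) (hq : q ∈ A)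
    (hD : cross (y - x) (q - x) ≠ 0)
    (h1 : 0 ≤ cross (p - x) (q - x) / cross (y - x) (q - x))
    (h2 : 0 ≤ cross (y - x) (p - x) / cross (y - x) (q - x))
    (h3 : cross (p - x) (q - x) / cross (y - x) (q - x) +
      cross (y - x) (p - x) / cross (y - x) (q - x) ≤ 1) : p ∈ A := by
  set α := cross (p - x) (q - x) / cross (y - x) (q - x) with hα
  set γ := cross (y - x) (p - x) / cross (y - x) (q - x) with hγ
  have hp : p = (1 - α - γ) • x + α • y + γ • q := by
    have h := cross_smul_eq (y - x) (q - x) (p - x)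
    have : p - x = α • (y - x) + γ • (q - x) := by
      rw [hα, hγ, div_eq_inv_mul, div_eq_inv_mul, mul_smul, mul_smul, ← smul_add, ← h, smul_smul,
        inv_mul_cancel₀ hD, one_smul]
    rw [sub_eq_iff_eq_add.1 this]
    module
  have := hA.sum_mem (t := Finset.univ) (w := ![1 - α - γ, α, γ]) (z := ![x, y, q])
    (by intro i _; fin_cases i <;> simp <;> linarith) (by simp [Fin.sum_univ_three]; ring)
    (by intro i _; fin_cases i <;> simpa)
  simpa [Fin.sum_univ_three, hp] using this

/-- Near an inner point of a segment in a convex set, the set contains the half-plane on the side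
of any further point of the set. -/
lemma eventually_mem_of_openSegment (hA : Convex ℝ A) (hx : x ∈ A) (hy : y ∈ A)
    (hq : q ∈ A) (hD : cross (y - x) (q - x) ≠ 0) (hm : m ∈ openSegment ℝ x y) :
    ∀ᶠ p in 𝓝 m, 0 ≤ cross (y - x) (p - x) * cross (y - x) (q - x) → p ∈ A := by
  rw [openSegment_eq_image'] at hm
  obtain ⟨s, ⟨hs0, hs1⟩, rfl⟩ := hm
  have c1 : Continuous fun p => cross (p - x) (q - x) / cross (y - x) (q - x) := by fun_prop
  have c2 : Continuous fun p => cross (p - x) (q - x) / cross (y - x) (q - x) +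
      cross (y - x) (p - x) / cross (y - x) (q - x) := by fun_prop
  filter_upwards
    [c1.continuousAt.eventually (eventually_gt_nhds (b := 0) (by simpa [hD] using hs0)),
      c2.continuousAt.eventually (eventually_lt_nhds (b := 1) (by simpa [hD] using hs1))]
    with p h1 h2 h
  refine mem_of_cross_div hA hx hy hq hD h1.le ?_ h2.le
  rw [div_eq_mul_inv, ← div_self_mul_self', ← mul_div_assoc]
  exact div_nonneg h (mul_self_nonneg _)

lemma exists_cross_ne_zero (hA : (interior A).Nonempty) (hxy : x ≠ y) :
    ∃ q ∈ A, cross (y - x) (q - x) ≠ 0 := by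
  by_contra! h
  obtain ⟨q, hq⟩ := hA
  have hc : ContinuousAt (fun w : Plane => q + w) 0 := by fun_prop
  have hev : ∀ᶠ w in 𝓝 (0 : Plane), q + w ∈ A :=
    hc.eventually (p := (· ∈ A)) (by simpa using mem_interior_iff_mem_nhds.1 hq)
  have hlin (w : Plane) : cross (y - x) w = 0 := by
    have hc : ContinuousAt (fun e : ℝ => e • w) 0 := by fun_prop
    have h1 : ∀ᶠ e in 𝓝[≠] (0 : ℝ), q + e • w ∈ A :=
      nhdsWithin_le_nhds (hc.eventually (p := fun w => q + w ∈ A) (by simpa using hev))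
    obtain ⟨e, he, he0⟩ := (h1.and self_mem_nhdsWithin).exists
    have h2 := h _ he
    rw [add_sub_right_comm, cross_add_right, h q (interior_subset hq), cross_smul_right,
      zero_add] at h2
    exact (mul_eq_zero.1 h2).resolve_left he0
  have h0 := hlin !₂[0, 1]
  have h1 := hlin !₂[1, 0]
  simp only [cross] at h0 h1
  refine hxy (sub_eq_zero.1 ?_).symm
  ext i
  fin_cases i
  · simpa using h0
  · simp only [Matrix.cons_val_one, Matrix.cons_val_zero] at h1
    simpa using (by linarith : (y - x) 1 = 0)

/-- Two convex sets with disjoint interiors that share two points lie on different sides of the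
line through these points. -/
lemma cross_mul_cross_nonpos (hA : Convex ℝ A) (hB : Convex ℝ B)
    (hAB : Disjoint (interior A) (interior B)) (hx : x ∈ A ∩ B) (hy : y ∈ A ∩ B)
    (hp : p ∈ A) (hq : q ∈ B) : cross (y - x) (p - x) * cross (y - x) (q - x) ≤ 0 := by
  by_contra! h
  have hP : cross (y - x) (p - x) ≠ 0 := left_ne_zero_of_mul h.ne'
  have hQ : cross (y - x) (q - x) ≠ 0 := right_ne_zero_of_mul h.ne'
  have hm : midpoint ℝ x y ∈ openSegment ℝ x y :=
    ⟨1 / 2, 1 / 2, by norm_num, by norm_num, by norm_num, by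
      rw [midpoint_eq_smul_add, smul_add]; norm_num⟩
  set m := midpoint ℝ x y with hmdef
  have hmx : cross (y - x) (m - x) = 0 := by simp [hmdef]
  have e1 := (eventually_mem_of_openSegment hA hx.1 hy.1 hp hP hm).eventually_nhds
  have e2 := (eventually_mem_of_openSegment hB hx.2 hy.2 hq hQ hm).eventually_nhds
  -- a small displacement of the midpoint towards `p` lies in both interiors
  have hc : ContinuousAt (fun e : ℝ => m + e • (p - x)) 0 := by fun_prop
  have hm0 : m = m + (0 : ℝ) • (p - x) := by simp
  have e12 := e1.and e2
  rw [hm0] at e12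
  have e3 := (hc.eventually e12).filter_mono (nhdsWithin_le_nhds (s := Ioi 0))
  obtain ⟨e, ⟨he1, he2⟩, he0⟩ := (e3.and self_mem_nhdsWithin).exists
  have c : Continuous fun p' => cross (y - x) (p' - x) * cross (y - x) (p - x) := by fun_prop
  have hpos : 0 < cross (y - x) (m + e • (p - x) - x) * cross (y - x) (p - x) := by
    rw [add_sub_right_comm, cross_add_right, hmx, cross_smul_right, zero_add, mul_assoc]
    exact mul_pos he0 (mul_self_pos.2 hP)
  have e4 := c.continuousAt.eventually (eventually_gt_nhds hpos)
  refine hAB.notMem_of_mem_left (a := m + e • (p - x)) (mem_interior_iff_mem_nhds.2 ?_)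
    (mem_interior_iff_mem_nhds.2 ?_)
  · filter_upwards [he1, e4] with p' h1 h4 using h1 h4.le
  · filter_upwards [he2, e4] with p' h2 h4
    refine h2 (le_of_lt ?_)
    have := mul_pos h4 h
    have h5 : 0 < cross (y - x) (p' - x) * cross (y - x) (q - x) * cross (y - x) (p - x) ^ 2 := by
      linarith
    exact pos_of_mul_pos_left h5 (sq_nonneg _)

/-- Convex sets with disjoint interiors fill a neighbourhood of each inner point of a common
segment. -/
lemma union_mem_nhds (hA : Convex ℝ A) (hB : Convex ℝ B) (hA' : (interior A).Nonempty)
    (hB' : (interior B).Nonempty) (hAB : Disjoint (interior A) (interior B)) (hxy : x ≠ y)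
    (hx : x ∈ A ∩ B) (hy : y ∈ A ∩ B) (hm : m ∈ openSegment ℝ x y) : A ∪ B ∈ 𝓝 m := by
  obtain ⟨p, hp, hP⟩ := exists_cross_ne_zero hA' hxy
  obtain ⟨q, hq, hQ⟩ := exists_cross_ne_zero hB' hxy
  have hneg := (cross_mul_cross_nonpos hA hB hAB hx hy hp hq).lt_of_ne (mul_ne_zero hP hQ)
  filter_upwards [eventually_mem_of_openSegment hA hx.1 hy.1 hp hP hm,
    eventually_mem_of_openSegment hB hx.2 hy.2 hq hQ hm] with w h1 h2
  by_contra! hw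
  simp only [mem_union, not_or] at hw
  have h1' := not_le.1 (mt h1 hw.1)
  have h2' := not_le.1 (mt h2 hw.2)
  have := mul_pos_of_neg_of_neg h1' h2'
  nlinarith [mul_nonneg (mul_self_nonneg (cross (y - x) (w - x))) (neg_nonneg.2 hneg.le)]

/-- One-sidedness: a common segment of two convex sets with disjoint interiors lies on the
boundary of each. -/
lemma exists_sign (hA : Convex ℝ A) (hB : Convex ℝ B) (hB' : (interior B).Nonempty)
    (hAB : Disjoint (interior A) (interior B)) (hxy : x ≠ y)
    (hx : x ∈ A ∩ B) (hy : y ∈ A ∩ B) :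
    ∃ τ : ℝ, τ ≠ 0 ∧ ∀ p ∈ A, 0 ≤ τ * cross (y - x) (p - x) := by
  obtain ⟨q, hq, hQ⟩ := exists_cross_ne_zero hB' hxy
  refine ⟨-cross (y - x) (q - x), neg_ne_zero.2 hQ, fun p hp => ?_⟩
  linarith [cross_mul_cross_nonpos hA hB hAB hx hy hp hq]

lemma mem_openSegment_of_eq_add_smul {t : ℝ} (h0 : 0 < t) (h1 : t < 1)
    (h : p - x = t • (y - x)) : p ∈ openSegment ℝ x y := by
  rw [openSegment_eq_image']
  exact ⟨t, ⟨h0, h1⟩, by simp [← h]⟩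

lemma lt_one_of_norm_lt {t : ℝ} (h0 : 0 < t) (h : p - x = t • (y - x)) (hp : ‖p - x‖ < ‖y - x‖) :
    t < 1 := by
  rw [h, norm_smul, Real.norm_of_nonneg h0.le] at hp
  by_contra! ht
  nlinarith [norm_nonneg (y - x)]

/-- Two boundary segments of a convex plane set that issue from `x` in different directions make up
the whole boundary near `x`: if the set together with neighbours covers a neighbourhood of every
inner point of these segments, it does so for all its points near `x`. -/
lemma eventually_mem_nhds_of_two_edges {C : Set Plane} (hA : Convex ℝ A)
    (hA' : (interior A).Nonempty) (hx : x ∈ A) (hy : y ∈ A) (hz : z ∈ A) (hyx : x ≠ y)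
    (hzx : x ≠ z) (hray : ∀ t : ℝ, 0 < t → z - x ≠ t • (y - x))
    (hτ : ∃ τ : ℝ, τ ≠ 0 ∧ ∀ p ∈ A, 0 ≤ τ * cross (y - x) (p - x))
    (hσ : ∃ σ : ℝ, σ ≠ 0 ∧ ∀ p ∈ A, 0 ≤ σ * cross (z - x) (p - x))
    (hAC : A ⊆ C) (hCy : ∀ m ∈ openSegment ℝ x y, C ∈ 𝓝 m)
    (hCz : ∀ m ∈ openSegment ℝ x z, C ∈ 𝓝 m) :
    ∀ᶠ p in 𝓝 x, p ∈ A → p ≠ x → C ∈ 𝓝 p := by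
  obtain ⟨τ, hτ0, hτ⟩ := hτ
  obtain ⟨σ, hσ0, hσ⟩ := hσ
  have hu : y - x ≠ 0 := sub_ne_zero.2 hyx.symm
  have hv : z - x ≠ 0 := sub_ne_zero.2 hzx.symm
  have hn : Continuous fun p : Plane => ‖p - x‖ := by fun_prop
  have n1 : ∀ᶠ p in 𝓝 x, ‖p - x‖ < ‖y - x‖ :=
    hn.continuousAt.eventually (eventually_lt_nhds (by simpa using hu))
  have n2 : ∀ᶠ p in 𝓝 x, ‖p - x‖ < ‖z - x‖ :=
    hn.continuousAt.eventually (eventually_lt_nhds (by simpa using hv))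
  -- points of the set on one of the two lines lie on one of the two segments
  have line : ∀ᶠ p in 𝓝 x, p ∈ A → p ≠ x →
      (cross (y - x) (p - x) = 0 ∨ cross (z - x) (p - x) = 0) → C ∈ 𝓝 p := by
    filter_upwards [n1, n2] with p h1 h2 hp hpx hor
    have hpx' : p - x ≠ 0 := sub_ne_zero.2 hpx
    rcases hor with h | h
    · obtain ⟨t, ht⟩ := exists_smul_of_cross_eq_zero hu h
      have ht0 : t ≠ 0 := by rintro rfl; exact hpx' (by simpa using ht)
      rcases ht0.lt_or_gt with htn | htp
      · have a1 := hσ p hp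
        have a2 := hσ y hy
        rw [ht, cross_smul_right] at a1
        have : cross (y - x) (z - x) = 0 := by
          rw [cross_swap]
          have : σ * cross (z - x) (y - x) = 0 := by nlinarith
          simpa [hσ0] using this
        obtain ⟨c, hc⟩ := exists_smul_of_cross_eq_zero hu this
        have hc0 : c < 0 := by
          by_contra! hc0
          rcases hc0.lt_or_eq with hc1 | hc1
          · exact hray c hc1 hc
          · exact hv (by simpa [← hc1] using hc)
        have hpz : p - x = (t / c) • (z - x) := by
          rw [hc, smul_smul, div_mul_cancel₀ _ hc0.ne, ht]
        have := div_pos_of_neg_of_neg htn hc0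
        exact hCz p (mem_openSegment_of_eq_add_smul this (lt_one_of_norm_lt this hpz h2) hpz)
      · exact hCy p (mem_openSegment_of_eq_add_smul htp (lt_one_of_norm_lt htp ht h1) ht)
    · obtain ⟨t, ht⟩ := exists_smul_of_cross_eq_zero hv h
      have ht0 : t ≠ 0 := by rintro rfl; exact hpx' (by simpa using ht)
      rcases ht0.lt_or_gt with htn | htp
      · have a1 := hτ p hp
        have a2 := hτ z hz
        rw [ht, cross_smul_right] at a1
        have : cross (z - x) (y - x) = 0 := by
          rw [cross_swap]
          have : τ * cross (y - x) (z - x) = 0 := by nlinarith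
          simpa [hτ0] using this
        obtain ⟨c, hc⟩ := exists_smul_of_cross_eq_zero hv this
        have hcn : c ≠ 0 := by rintro rfl; exact hu (by simpa using hc)
        have hc0 : c < 0 := by
          by_contra! hc0
          refine hray c⁻¹ (inv_pos.2 (hc0.lt_of_ne' hcn)) ?_
          rw [hc, smul_smul, inv_mul_cancel₀ hcn, one_smul]
        have hpy : p - x = (t / c) • (y - x) := by
          rw [hc, smul_smul, div_mul_cancel₀ _ hc0.ne, ht]
        have := div_pos_of_neg_of_neg htn hc0
        exact hCy p (mem_openSegment_of_eq_add_smul this (lt_one_of_norm_lt this hpy h1) hpy)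
      · exact hCz p (mem_openSegment_of_eq_add_smul htp (lt_one_of_norm_lt htp ht h2) ht)
  -- points of the set off these lines are inner points
  have off : ∀ᶠ p in 𝓝 x, p ∈ A → cross (y - x) (p - x) ≠ 0 → cross (z - x) (p - x) ≠ 0 →
      A ∈ 𝓝 p := by
    by_cases hD : cross (y - x) (z - x) = 0
    · -- the segments are opposite, and the set is a half-plane near `x`
      obtain ⟨c, hc⟩ := exists_smul_of_cross_eq_zero hu hD
      have hc0 : c < 0 := by
        by_contra! hc0
        rcases hc0.lt_or_eq with hc1 | hc1
        · exact hray c hc1 hc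
        · exact hv (by simpa [← hc1] using hc)
      have hxm : x ∈ openSegment ℝ y z := by
        have h1 : (0 : ℝ) < 1 - c := by linarith
        refine ⟨-c / (1 - c), 1 / (1 - c), by apply div_pos <;> linarith, by positivity,
          by field_simp; ring, ?_⟩
        have hz' : z = c • (y - x) + x := by rw [← hc]; simp
        have : -c / (1 - c) = 1 - 1 / (1 - c) := by field_simp; ring
        have h2 : (1 / (1 - c)) * (1 - c) = 1 := by field_simp
        rw [hz', this]
        have h3 : (1 - 1 / (1 - c)) • y + (1 / (1 - c)) • (c • (y - x) + x) =
          (1 - (1 / (1 - c)) * (1 - c)) • y + ((1 / (1 - c)) * (1 - c)) • x := by module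
        rw [h3, h2]; simp
      obtain ⟨q, hq, hQ⟩ := exists_cross_ne_zero hA' hyx
      have key (p : Plane) : cross (z - y) (p - y) = (c - 1) * cross (y - x) (p - x) := by
        have h1 : z - y = (c - 1) • (y - x) := by
          rw [sub_smul, ← hc, one_smul]; abel
        have h2 : p - y = (p - x) + (-1 : ℝ) • (y - x) := by module
        rw [h1, h2, cross_smul_left, cross_add_right, cross_smul_right, cross_self]; ring
      have hcne : c - 1 ≠ 0 := by linarith
      filter_upwards [(eventually_mem_of_openSegment hA hy hz hq
        (by rw [key]; exact mul_ne_zero hcne hQ) hxm).eventually_nhds] with p hev hp hp1 _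
      have hQ' : 0 < τ * cross (y - x) (q - x) := (hτ q hq).lt_of_ne' (mul_ne_zero hτ0 hQ)
      have hP' : 0 < τ * cross (y - x) (p - x) := (hτ p hp).lt_of_ne' (mul_ne_zero hτ0 hp1)
      have ct : Continuous fun p => τ * cross (y - x) (p - x) := by fun_prop
      filter_upwards [hev, ct.continuousAt.eventually (eventually_gt_nhds hP')] with w h1 h2
      refine h1 ?_
      rw [key, key]
      have h3 := mul_pos h2 hQ'
      have h4 : 0 ≤ cross (y - x) (w - x) * cross (y - x) (q - x) :=
        le_of_lt (pos_of_mul_pos_left (b := τ ^ 2) (by linarith) (sq_nonneg _))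
      nlinarith [mul_nonneg (sq_nonneg (c - 1)) h4]
    · -- the set is a sector near `x`
      have c1 : Continuous fun p => cross (p - x) (z - x) / cross (y - x) (z - x) := by fun_prop
      have c2 : Continuous fun p => cross (y - x) (p - x) / cross (y - x) (z - x) := by fun_prop
      have c3 := c1.add c2
      filter_upwards [c3.continuousAt.eventually (eventually_lt_nhds (b := 1) (by simp))]
        with p h3 hp hp1 hp2
      have sy : 0 < σ * cross (z - x) (y - x) := (hσ y hy).lt_of_ne'
        (mul_ne_zero hσ0 (by rw [cross_swap]; exact neg_ne_zero.2 hD))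
      have sp : 0 < σ * cross (z - x) (p - x) := (hσ p hp).lt_of_ne' (mul_ne_zero hσ0 hp2)
      have tz : 0 < τ * cross (y - x) (z - x) := (hτ z hz).lt_of_ne' (mul_ne_zero hτ0 hD)
      have tp : 0 < τ * cross (y - x) (p - x) := (hτ p hp).lt_of_ne' (mul_ne_zero hτ0 hp1)
      have h1 : 0 < cross (p - x) (z - x) / cross (y - x) (z - x) := by
        rw [cross_swap (z - x) (p - x), cross_swap (z - x) (y - x), neg_div_neg_eq,
          ← mul_div_mul_left _ _ hσ0]
        exact div_pos sp sy
      have h2 : 0 < cross (y - x) (p - x) / cross (y - x) (z - x) := by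
        rw [← mul_div_mul_left _ _ hτ0]
        exact div_pos tp tz
      filter_upwards [c1.continuousAt.eventually (eventually_gt_nhds h1),
        c2.continuousAt.eventually (eventually_gt_nhds h2),
        c3.continuousAt.eventually (eventually_lt_nhds h3)] with w w1 w2 w3
      exact mem_of_cross_div hA hx hy hz hD w1.le w2.le w3.le
  filter_upwards [line, off] with p h1 h2 hp hpx
  by_cases h : cross (y - x) (p - x) = 0 ∨ cross (z - x) (p - x) = 0
  · exact h1 hp hpx h
  · push Not at h
    exact Filter.mem_of_superset (h2 hp h.1 h.2) hAC

/-- A closed plane set that is open near `x`, except possibly at `x` itself, and that contains a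
segment ending at `x`, is a neighbourhood of `x`: small circles around `x` are connected. -/
lemma mem_nhds_of_punctured {W : Set Plane} (hW : IsClosed W) (hxy : x ≠ y)
    (hseg : segment ℝ x y ⊆ W) (h : ∀ᶠ p in 𝓝 x, p ∈ W → p ≠ x → W ∈ 𝓝 p) : W ∈ 𝓝 x := by
  obtain ⟨ε, hε, hball⟩ := Metric.eventually_nhds_iff.1 h
  have hd : 0 < dist y x := dist_pos.2 hxy.symm
  refine Metric.mem_nhds_iff.2 ⟨min ε (dist y x), lt_min hε hd, fun p hp => ?_⟩
  rcases eq_or_ne p x with rfl | hpx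
  · exact hseg (left_mem_segment ℝ _ _)
  have hr0 : 0 < dist p x := dist_pos.2 hpx
  have hr1 : dist p x < ε := (lt_min_iff.1 hp).1
  have hr2 : dist p x < dist y x := (lt_min_iff.1 hp).2
  have hrank : 1 < Module.rank ℝ Plane := by
    rw [← Module.finrank_eq_rank, finrank_euclideanSpace_fin]; norm_num
  have hsub : Metric.sphere x (dist p x) ⊆ interior W := by
    refine (isPreconnected_sphere hrank x (dist p x)).subset_left_of_subset_union
      isOpen_interior hW.isOpen_compl
      (disjoint_compl_right.mono_left interior_subset) (fun w hw => ?_) ?_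
    · by_cases hwW : w ∈ W
      · exact .inl (mem_interior_iff_mem_nhds.2
          (hball
          (by rw [Metric.mem_sphere.1 hw]; exact hr1) hwW (Metric.ne_of_mem_sphere hw hr0.ne')))
      · exact .inr hwW
    · set t := dist p x / dist y x
      have ht : 0 < t := div_pos hr0 hd
      have ht1 : t ≤ 1 := (div_le_one hd).2 hr2.le
      have hdist : dist (x + t • (y - x)) x = dist p x := by
        rw [dist_eq_norm, add_sub_cancel_left, norm_smul, Real.norm_of_nonneg ht.le,
          ← dist_eq_norm, div_mul_cancel₀ _ hd.ne']
      have hmem : x + t • (y - x) ∈ W :=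
        hseg (by rw [segment_eq_image']; exact ⟨t, ⟨ht.le, ht1⟩, rfl⟩)
      refine ⟨x + t • (y - x), hdist, mem_interior_iff_mem_nhds.2
        (hball (by rw [hdist]; exact hr1) hmem ?_)⟩
      intro h0
      rw [h0, dist_self] at hdist
      exact hr0.ne hdist
  exact interior_subset (hsub (Metric.mem_sphere.2 rfl))

end Plane

/-! ### The cells around a point -/

namespace ConvexDissection

variable {X : Set Plane} {ι : Type*} (D : ConvexDissection X ι) {i j k : ι} {x y m : Plane}

lemma convex_cell (i : ι) : Convex ℝ (D.cell i) := by
  obtain ⟨S, hS⟩ := (D.isConvexPolygon_cell i).1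
  rw [hS]
  exact convex_convexHull ℝ _

lemma isClosed_cell (i : ι) : IsClosed (D.cell i) := by
  obtain ⟨S, hS⟩ := (D.isConvexPolygon_cell i).1
  rw [hS]
  exact S.finite_toSet.isClosed_convexHull ℝ

lemma cell_subset (i : ι) : D.cell i ⊆ X := fun _ h => D.iUnion_cell ▸ mem_iUnion_of_mem i h

lemma exists_mem_cell (hx : x ∈ X) : ∃ i, x ∈ D.cell i := by
  rw [← D.iUnion_cell] at hx
  exact mem_iUnion.1 hx

/-- A cell that contains the given point. -/
noncomputable def cellAt (z : X) : ι := (D.exists_mem_cell z.2).choose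

lemma mem_cellAt (z : X) : (z : Plane) ∈ D.cell (D.cellAt z) :=
  (D.exists_mem_cell z.2).choose_spec

lemma cell_subset_closure_interior (i : ι) : D.cell i ⊆ closure (interior (D.cell i)) := by
  rw [(D.convex_cell i).closure_interior_eq_closure_of_nonempty_interior
    (D.isConvexPolygon_cell i).2]
  exact subset_closure

lemma exists_ne_mem_cell (i : ι) (x : Plane) : ∃ y ∈ D.cell i, x ≠ y := by
  obtain ⟨q, hq⟩ := (D.isConvexPolygon_cell i).2
  by_contra! h
  have hsub : D.cell i ⊆ {x} := fun y hy => (h y hy).symm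
  have := interior_mono hsub hq
  rw [interior_singleton] at this
  exact this

/-- A cell that meets the interior of the union of two cells is one of these. -/
lemma eq_or_eq_of_union_mem_nhds (h : D.cell i ∪ D.cell j ∈ 𝓝 m) (hk : m ∈ D.cell k) :
    k = i ∨ k = j := by
  by_contra! hne
  obtain ⟨p, hp, hpk⟩ := mem_closure_iff_nhds.1 (D.cell_subset_closure_interior k hk) _ h
  obtain ⟨l, hl, hpl⟩ : ∃ l, k ≠ l ∧ p ∈ D.cell l :=
    hp.elim (fun h => ⟨i, hne.1, h⟩) fun h => ⟨j, hne.2, h⟩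
  exact ((D.disjoint_interior k l hl).closure_right isOpen_interior).notMem_of_mem_left
    hpk (D.cell_subset_closure_interior l hpl)

lemma union_cell_mem_nhds (hij : i ≠ j) (hxy : x ≠ y) (hx : x ∈ D.cell i ∩ D.cell j)
    (hy : y ∈ D.cell i ∩ D.cell j) (hm : m ∈ openSegment ℝ x y) : D.cell i ∪ D.cell j ∈ 𝓝 m :=
  union_mem_nhds (D.convex_cell i) (D.convex_cell j) (D.isConvexPolygon_cell i).2
    (D.isConvexPolygon_cell j).2 (D.disjoint_interior i j hij) hxy hx hy hm

variable {D} in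
lemma exists_ne_mem_inter_of_adj (h : D.topologyGraph.Adj i j) (x : Plane) :
    ∃ y ∈ D.cell i ∩ D.cell j, x ≠ y := by
  obtain ⟨y, hy, hne⟩ := h.2.exists_ne x
  exact ⟨y, hy, hne.symm⟩

variable {D} in
lemma exists_sign_of_adj (h : D.topologyGraph.Adj i j) (hxy : x ≠ y)
    (hx : x ∈ D.cell i ∩ D.cell j) (hy : y ∈ D.cell i ∩ D.cell j) :
    ∃ τ : ℝ, τ ≠ 0 ∧ ∀ p ∈ D.cell i, 0 ≤ τ * cross (y - x) (p - x) :=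
  exists_sign (D.convex_cell i) (D.convex_cell j) (D.isConvexPolygon_cell j).2
    (D.disjoint_interior i j h.1) hxy hx hy

/-- A cell with two neighbours at `x` is surrounded by itself and these neighbours, near `x` and
except at `x`. -/
lemma eventually_mem_nhds_of_two_neighbors (hij : D.topologyGraph.Adj i j)
    (hik : D.topologyGraph.Adj i k) (hjk : j ≠ k) (hi : x ∈ D.cell i) (hj : x ∈ D.cell j)
    (hk : x ∈ D.cell k) {W : Set Plane} (hWi : D.cell i ⊆ W) (hWj : D.cell j ⊆ W)
    (hWk : D.cell k ⊆ W) : ∀ᶠ p in 𝓝 x, p ∈ D.cell i → p ≠ x → W ∈ 𝓝 p := by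
  obtain ⟨y, hy, hxy⟩ := exists_ne_mem_inter_of_adj hij x
  obtain ⟨z, hz, hxz⟩ := exists_ne_mem_inter_of_adj hik x
  refine eventually_mem_nhds_of_two_edges (D.convex_cell i) (D.isConvexPolygon_cell i).2 hi hy.1
    hz.1 hxy hxz (fun t ht htz => ?_) (exists_sign_of_adj hij hxy ⟨hi, hj⟩ hy)
    (exists_sign_of_adj hik hxz ⟨hi, hk⟩ hz) hWi
    (fun m hm => Filter.mem_of_superset (D.union_cell_mem_nhds hij.1 hxy ⟨hi, hj⟩ hy hm)
      (union_subset hWi hWj))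
    (fun m hm => Filter.mem_of_superset (D.union_cell_mem_nhds hik.1 hxz ⟨hi, hk⟩ hz hm)
      (union_subset hWi hWk))
  -- if both shared edges had the same direction, three cells would meet in inner points of both
  set r := min (1 / 2) (t / 2)
  have hr0 : 0 < r := lt_min (by norm_num) (by positivity)
  have hr1 : r < 1 := (min_le_left _ _).trans_lt (by norm_num)
  have hrt : r / t < 1 := by
    rw [div_lt_one ht]
    exact (min_le_right _ _).trans_lt (by linarith)
  have hmy : x + r • (y - x) ∈ openSegment ℝ x y :=
    mem_openSegment_of_eq_add_smul hr0 hr1 (by simp)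
  have hmz : x + r • (y - x) ∈ openSegment ℝ x z :=
    mem_openSegment_of_eq_add_smul (div_pos hr0 ht) hrt
      (by rw [htz, smul_smul, div_mul_cancel₀ _ ht.ne']; simp)
  have hmk : x + r • (y - x) ∈ D.cell k :=
    (D.convex_cell k).openSegment_subset hk hz.2 hmz
  rcases D.eq_or_eq_of_union_mem_nhds (D.union_cell_mem_nhds hij.1 hxy ⟨hi, hj⟩ hy hmy) hmk with
    h | h
  · exact hik.1 h.symm
  · exact hjk h.symm

/-- Around a point, adjacency has no cycles: in any set of cells at `x`, some cell has at most one
neighbour. Otherwise these cells would fill a neighbourhood of `x`, and a cutline with `x` as an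
inner point would separate just two of them. -/
lemma exists_leaf [Finite ι] {S : Finset ι} (hS : S.Nonempty) (hxS : ∀ i ∈ S, x ∈ D.cell i) :
    ∃ i ∈ S, ∀ j ∈ S, ∀ k ∈ S, D.topologyGraph.Adj i j → D.topologyGraph.Adj i k → j = k := by
  by_contra! h
  set W : Set Plane := ⋃ i ∈ S, D.cell i with hWdef
  have hsub : ∀ i ∈ S, D.cell i ⊆ W := fun i hi => subset_biUnion_of_mem (u := D.cell) hi
  have hWX : W ⊆ X := iUnion₂_subset fun i _ => D.cell_subset i
  have hWc : IsClosed W := S.finite_toSet.isClosed_biUnion fun i _ => D.isClosed_cell i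
  have hev : ∀ᶠ p in 𝓝 x, ∀ i ∈ S, p ∈ D.cell i → p ≠ x → W ∈ 𝓝 p := by
    refine (Filter.eventually_all_finset S).2 fun i hi => ?_
    obtain ⟨j, hj, k, hk, hij, hik, hjk⟩ := h i hi
    exact D.eventually_mem_nhds_of_two_neighbors hij hik hjk (hxS i hi) (hxS j hj) (hxS k hk)
      (hsub i hi) (hsub j hj) (hsub k hk)
  obtain ⟨i, hi⟩ := hS
  obtain ⟨y, hy, hxy⟩ := D.exists_ne_mem_cell i x
  have hWx : W ∈ 𝓝 x := by
    refine mem_nhds_of_punctured hWc hxy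
      (((D.convex_cell i).segment_subset (hxS i hi) hy).trans (hsub i hi)) ?_
    filter_upwards [hev] with p hp hpW hpx
    obtain ⟨l, hl, hpl⟩ := mem_iUnion₂.1 hpW
    exact hp l hl hpl hpx
  obtain ⟨j, hj, k, hk, hij, hik, hjk⟩ := h i hi
  have hnf : x ∉ frontier X := fun hf =>
    hf.2 (mem_interior_iff_mem_nhds.2 (Filter.mem_of_superset hWx hWX))
  have hne : x ∉ (D.cell i ∩ D.cell j).extremePoints ℝ := fun he =>
    hnf (D.endpoint_cutline i j hij.1 hij.2 he)
  rw [mem_extremePoints] at hne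
  push Not at hne
  obtain ⟨p, hp, q, hq, hpq, hpq'⟩ := hne ⟨hxS i hi, hxS j hj⟩
  have hpne : p ≠ q := by
    rintro rfl
    rw [openSegment_same] at hpq
    exact hpq' hpq.symm hpq.symm
  rcases D.eq_or_eq_of_union_mem_nhds (D.union_cell_mem_nhds hij.1 hpne hp hq hpq) (hxS k hk) with
    h | h
  · exact hik.1 h.symm
  · exact hjk h.symm

/-- Two cells that contain `x`, with a cutline through `x` in common. -/
def AdjAt (x : Plane) (i j : ι) : Prop :=
  D.topologyGraph.Adj i j ∧ x ∈ D.cell i ∧ x ∈ D.cell j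

/-- A neighbourhood of `x` that meets no cell except those that contain `x`. -/
lemma isOpen_setOf_forall_mem_cell [Finite ι] (x : Plane) :
    IsOpen {y | ∀ i, y ∈ D.cell i → x ∈ D.cell i} := by
  have : {y | ∀ i, y ∈ D.cell i → x ∈ D.cell i} = ⋂ i : {i // x ∉ D.cell i}, (D.cell i)ᶜ := by
    ext y
    simp [not_imp_not]
  rw [this]
  exact isOpen_iInter_of_finite fun i => (D.isClosed_cell i).isOpen_compl

/-- The cells at a point that is not a pinch point are connected through cutlines at this point. -/
lemma reflTransGen_adjAt [Finite ι] (hX : NoPinchPoint X) (hi : x ∈ D.cell i)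
    (hj : x ∈ D.cell j) : Relation.ReflTransGen (D.AdjAt x) i j := by
  by_contra hij
  obtain ⟨V, hV, hVU, hconn⟩ := hX x (D.cell_subset i hi) _
    ((D.isOpen_setOf_forall_mem_cell x).mem_nhds fun _ h => h)
  set R : Set ι := {k | x ∈ D.cell k ∧ Relation.ReflTransGen (D.AdjAt x) i k}
  set R' : Set ι := {k | x ∈ D.cell k ∧ ¬ Relation.ReflTransGen (D.AdjAt x) i k}
  have hcl (S : Set ι) : IsClosed (⋃ k ∈ S, D.cell k) :=
    S.toFinite.isClosed_biUnion fun k _ => D.isClosed_cell k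
  have hne (k : ι) (hk : x ∈ D.cell k) : ∃ p ∈ (V ∩ X) \ {x}, p ∈ D.cell k := by
    obtain ⟨y, hy, hxy⟩ := D.exists_ne_mem_cell k x
    have hc : ContinuousAt (fun e : ℝ => x + e • (y - x)) 0 := by fun_prop
    have e1 : ∀ᶠ e in 𝓝[>] (0 : ℝ), x + e • (y - x) ∈ V :=
      (hc.eventually (p := (· ∈ V)) (by simpa using hV)).filter_mono nhdsWithin_le_nhds
    have e2 : ∀ᶠ e in 𝓝[>] (0 : ℝ), e < 1 :=
      (eventually_lt_nhds zero_lt_one).filter_mono nhdsWithin_le_nhds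
    obtain ⟨e, ⟨he1, he2⟩, he0⟩ := ((e1.and e2).and self_mem_nhdsWithin).exists
    have hmem : x + e • (y - x) ∈ D.cell k :=
      (D.convex_cell k).segment_subset hk hy
        (by rw [segment_eq_image']; exact ⟨e, ⟨le_of_lt he0, he2.le⟩, rfl⟩)
    refine ⟨_, ⟨⟨he1, D.cell_subset k hmem⟩, fun h => ?_⟩, hmem⟩
    have h' : e • (y - x) = 0 := by simpa using h
    rcases smul_eq_zero.1 h' with h' | h'
    · exact (ne_of_gt he0) h'
    · exact hxy (sub_eq_zero.1 h').symm
  obtain ⟨p, hpi, hpi'⟩ := hne i hi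
  obtain ⟨q, hqj, hqj'⟩ := hne j hj
  obtain ⟨w, hw, hw1, hw2⟩ := isPreconnected_closed_iff.1 hconn _ _ (hcl R) (hcl R')
    (fun p hp => by
      obtain ⟨k, hk⟩ := D.exists_mem_cell hp.1.2
      have hxk := hVU hp.1.1 k hk
      by_cases hR : Relation.ReflTransGen (D.AdjAt x) i k
      · exact .inl (mem_iUnion₂.2 ⟨k, ⟨hxk, hR⟩, hk⟩)
      · exact .inr (mem_iUnion₂.2 ⟨k, ⟨hxk, hR⟩, hk⟩))
    ⟨p, hpi, mem_iUnion₂.2 ⟨i, ⟨hi, .refl⟩, hpi'⟩⟩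
    ⟨q, hqj, mem_iUnion₂.2 ⟨j, ⟨hj, hij⟩, hqj'⟩⟩
  obtain ⟨k, ⟨hk, hRk⟩, hwk⟩ := mem_iUnion₂.1 hw1
  obtain ⟨l, ⟨hl, hRl⟩, hwl⟩ := mem_iUnion₂.1 hw2
  refine hRl (hRk.tail ⟨⟨?_, ?_⟩, hk, hl⟩)
  · rintro rfl
    exact hRl hRk
  · exact ⟨x, ⟨hk, hl⟩, w, ⟨hwk, hwl⟩, fun h => hw.2 h.symm⟩

/-- The steps between the cells at `x` form a coboundary, since adjacency has no cycles there. -/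
lemma exists_potential [Finite ι] (x : Plane) : ∃ h : ι → FreeGroup (ι × ι),
    ∀ i j, D.AdjAt x i j → h j = h i * step i j := by
  classical
  have key (n : ℕ) : ∀ S : Finset ι, S.card = n → (∀ i ∈ S, x ∈ D.cell i) →
      ∃ h : ι → FreeGroup (ι × ι), ∀ i ∈ S, ∀ j ∈ S, D.topologyGraph.Adj i j →
        h j = h i * step i j := by
    induction n with
    | zero =>
      intro S hS _
      rw [Finset.card_eq_zero] at hS
      exact ⟨1, by simp [hS]⟩
    | succ n ih =>
      intro S hS hxS
      obtain ⟨l, hl, hleaf⟩ := D.exists_leaf (Finset.card_pos.1 (by omega)) hxS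
      obtain ⟨h, hh⟩ := ih (S.erase l) (by rw [Finset.card_erase_of_mem hl]; omega)
        fun i hi => hxS i (Finset.mem_of_mem_erase hi)
      obtain ⟨v, hv⟩ : ∃ v, ∀ j ∈ S, D.topologyGraph.Adj l j → v = h j * step j l := by
        by_cases hn : ∃ j ∈ S, D.topologyGraph.Adj l j
        · obtain ⟨j, hj, hlj⟩ := hn
          exact ⟨h j * step j l, fun k hk hlk => by rw [hleaf j hj k hk hlj hlk]⟩
        · exact ⟨1, fun j hj hlj => (hn ⟨j, hj, hlj⟩).elim⟩
      refine ⟨Function.update h l v, fun i hi j hj hij => ?_⟩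
      rcases eq_or_ne i l with rfl | hil
      · rw [Function.update_self, Function.update_of_ne hij.ne', hv j hj hij, mul_assoc,
          step_mul_step_swap, mul_one]
      rcases eq_or_ne j l with rfl | hjl
      · rw [Function.update_self, Function.update_of_ne hil, hv i hi hij.symm]
      · rw [Function.update_of_ne hil, Function.update_of_ne hjl]
        exact hh i (Finset.mem_erase.2 ⟨hil, hi⟩) j (Finset.mem_erase.2 ⟨hjl, hj⟩) hij
  have := Fintype.ofFinite ι
  obtain ⟨h, hh⟩ := key _ (Finset.univ.filter fun i => x ∈ D.cell i) rfl (by simp)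
  exact ⟨h, fun i j hij => hh i (by simpa using hij.2.1) j (by simpa using hij.2.2) hij.1⟩

end ConvexDissection

open Path.Homotopic (Quotient)

/-! ### Homotopy classes of paths inside a subset -/

section ClassIn

variable {X S T : Set Plane} {x y z : X}

/-- A homotopy class of paths in `X` that has a representative inside `S`. -/
def ClassIn (S : Set Plane) (q : Quotient x y) : Prop :=
  ∃ f : Path x y, (∀ t, (f t : Plane) ∈ S) ∧ Path.Homotopic.Quotient.mk f = q

lemma ClassIn.mono {q : Quotient x y} (h : ClassIn S q) (hST : S ⊆ T) : ClassIn T q :=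
  let ⟨f, hf, hq⟩ := h
  ⟨f, fun t => hST (hf t), hq⟩

lemma ClassIn.refl (hx : (x : Plane) ∈ S) : ClassIn S (Quotient.refl x) :=
  ⟨Path.refl x, fun _ => hx, rfl⟩

lemma ClassIn.trans {p : Quotient x y} {q : Quotient y z} (hp : ClassIn S p) (hq : ClassIn S q) :
    ClassIn S (p.trans q) := by
  obtain ⟨f, hf, rfl⟩ := hp
  obtain ⟨g, hg, rfl⟩ := hq
  refine ⟨f.trans g, fun t => ?_, rfl⟩
  rw [Path.trans_apply]
  split_ifs
  · exact hf _
  · exact hg _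

lemma ClassIn.symm {p : Quotient x y} (hp : ClassIn S p) : ClassIn S p.symm := by
  obtain ⟨f, hf, rfl⟩ := hp
  exact ⟨f.symm, fun t => hf _, rfl⟩

lemma ClassIn.source_mem {q : Quotient x y} (h : ClassIn S q) : (x : Plane) ∈ S := by
  obtain ⟨f, hf, -⟩ := h
  simpa using hf 0

lemma ClassIn.eq_of_starConvex {c : Plane} (hS : StarConvex ℝ c S) (hSX : S ⊆ X)
    {p q : Quotient x y} (hp : ClassIn S p) (hq : ClassIn S q) : p = q := by
  have hx := hp.source_mem
  obtain ⟨f, hf, rfl⟩ := hp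
  obtain ⟨g, hg, rfl⟩ := hq
  have hy : (y : Plane) ∈ S := by simpa using hf 1
  have := hS.contractibleSpace ⟨x, hx⟩
  let lift (f : Path x y) (hf : ∀ t, (f t : Plane) ∈ S) : Path (⟨x, hx⟩ : S) ⟨y, hy⟩ :=
    { toFun := fun t => ⟨f t, hf t⟩
      continuous_toFun := by fun_prop
      source' := by simp
      target' := by simp }
  let inc : C(S, X) := ⟨Set.inclusion hSX, continuous_inclusion hSX⟩
  have h := (SimplyConnectedSpace.paths_homotopic (lift f hf) (lift g hg)).map inc
  exact Path.Homotopic.Quotient.eq.2 h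

lemma ClassIn.eq_of_convex (hS : Convex ℝ S) (hSX : S ⊆ X)
    {p q : Quotient x y} (hp : ClassIn S p) (hq : ClassIn S q) : p = q :=
  hp.eq_of_starConvex (hS.starConvex hp.source_mem) hSX hq

lemma exists_classIn (hS : Convex ℝ S) (hSX : S ⊆ X) (hx : (x : Plane) ∈ S)
    (hy : (y : Plane) ∈ S) : ∃ q : Quotient x y, ClassIn S q := by
  obtain ⟨f, hf⟩ := (hS.isPathConnected ⟨x, hx⟩).joinedIn x hx y hy
  let g : Path x y :=
    { toFun := fun t => ⟨f t, hSX (hf t)⟩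
      continuous_toFun := by fun_prop
      source' := by simp
      target' := by simp }
  exact ⟨_, g, hf, rfl⟩

end ClassIn

namespace ConvexDissection

variable {X : Set Plane} {ι : Type*} (D : ConvexDissection X ι)

/-! ### Homotopy classes that pass a sequence of cells -/

/-- The homotopy class `q` passes the cells of the list in order: it is a product of classes, one
inside each cell of the list. -/
inductive Realizes : List ι → ∀ {x y : X}, Quotient x y → Prop
  | single {i : ι} {x y : X} {q : Quotient x y} : ClassIn (D.cell i) q → Realizes [i] q
  | cons {i : ι} {L : List ι} {x y z : X} {p : Quotient x y} {q : Quotient y z} :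
      ClassIn (D.cell i) p → Realizes L q → Realizes (i :: L) (p.trans q)

variable {D} {i j a b : ι} {L L' : List ι} {x y z : X}

lemma Realizes.cons_inv {q : Quotient x z} (h : D.Realizes (i :: j :: L) q) :
    ∃ (y : X) (p : Quotient x y) (q' : Quotient y z), ClassIn (D.cell i) p ∧
      D.Realizes (j :: L) q' ∧ q = p.trans q' := by
  cases h with
  | cons hp hq => exact ⟨_, _, _, hp, hq, rfl⟩

lemma Realizes.single_inv {q : Quotient x z} (h : D.Realizes [i] q) : ClassIn (D.cell i) q := by
  cases h with
  | single h => exact h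
  | cons _ h => nomatch h

lemma Realizes.source_mem {q : Quotient x z} (h : D.Realizes (i :: L) q) :
    (x : Plane) ∈ D.cell i := by
  cases h with
  | single h => exact h.source_mem
  | cons h _ => exact h.source_mem

lemma Realizes.append {p : Quotient x y} (hp : D.Realizes L p) {q : Quotient y z}
    (hq : D.Realizes L' q) : D.Realizes (L ++ L') (p.trans q) := by
  induction hp with
  | single h => exact .cons h hq
  | cons h _ ih =>
    rw [Path.Homotopic.Quotient.trans_assoc]
    exact .cons h (ih hq)

lemma Realizes.trans_left {s : Quotient x y} (hs : ClassIn (D.cell i) s) {q : Quotient y z}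
    (hq : D.Realizes (i :: L) q) : D.Realizes (i :: L) (s.trans q) := by
  cases hq with
  | single h => exact .single (hs.trans h)
  | cons h hq =>
    rw [← Path.Homotopic.Quotient.trans_assoc]
    exact .cons (hs.trans h) hq

/-- A sequence of cells determines the class: points at which two classes change from one cell to
the next can be joined inside the intersection of both cells. -/
lemma Realizes.eq_trans : ∀ {L : List ι} {i : ι} {x x' y : X} {q : Quotient x y}
    {q' : Quotient x' y} {s : Quotient x x'}, D.Realizes (i :: L) q → D.Realizes (i :: L) q' →
    ClassIn (D.cell i) s → q = s.trans q'
  | [], i, _, _, _, _, _, _, hq, hq', hs =>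
    hq.single_inv.eq_of_convex (D.convex_cell i) (D.cell_subset i) (hs.trans hq'.single_inv)
  | j :: L, i, x, x', y, q, q', s, hq, hq', hs => by
    obtain ⟨w, p, r, hp, hr, rfl⟩ := hq.cons_inv
    obtain ⟨w', p', r', hp', hr', rfl⟩ := hq'.cons_inv
    have hmem {x w : X} {p : Quotient x w} (hp : ClassIn (D.cell i) p) :
        (w : Plane) ∈ D.cell i := hp.symm.source_mem
    obtain ⟨m, hm⟩ := exists_classIn ((D.convex_cell i).inter (D.convex_cell j))
      (inter_subset_left.trans (D.cell_subset i)) ⟨hmem hp, hr.source_mem⟩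
      ⟨hmem hp', hr'.source_mem⟩
    rw [eq_trans hr hr' (hm.mono inter_subset_right), ← Path.Homotopic.Quotient.trans_assoc,
      ← Path.Homotopic.Quotient.trans_assoc]
    congr 1
    exact (hp.trans (hm.mono inter_subset_left)).eq_of_convex (D.convex_cell i) (D.cell_subset i)
      (hs.trans hp')

lemma Realizes.unique {u : TopoPath D.topologyGraph a b} {q q' : Quotient x y}
    (h : D.Realizes u.nodes q) (h' : D.Realizes u.nodes q') : q = q' := by
  obtain ⟨L, hL⟩ := u.exists_nodes_eq_cons
  rw [hL] at h h'
  simpa using h.eq_trans h' (.refl h.source_mem)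

lemma Realizes.append_cons_congr {r r' : List ι} (key : ∀ {x : X} {q : Quotient x y},
    D.Realizes (i :: r) q → D.Realizes (i :: r') q) :
    ∀ (l : List ι) {x : X} {q : Quotient x y}, D.Realizes (l ++ i :: r) q →
      D.Realizes (l ++ i :: r') q
  | [], _, _, h => key h
  | [_], _, _, h => by
    obtain ⟨_, _, _, h1, h2, rfl⟩ := h.cons_inv
    exact .cons h1 (key h2)
  | _ :: j :: l, _, _, h => by
    obtain ⟨_, _, _, h1, h2, rfl⟩ := Realizes.cons_inv (L := l ++ i :: r) h
    exact .cons h1 (append_cons_congr key (j :: l) h2)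

lemma exists_mem_inter_of_eq_or_adj (h : i = j ∨ D.topologyGraph.Adj i j) :
    ∃ p, p ∈ D.cell i ∩ D.cell j := by
  rcases h with rfl | h
  · obtain ⟨p, hp⟩ := (D.isConvexPolygon_cell i).2
    exact ⟨p, interior_subset hp, interior_subset hp⟩
  · exact h.2.nonempty

lemma Realizes.of_extension {u v : TopoPath D.topologyGraph a b} (huv : u.Extension v)
    {q : Quotient x y} (h : D.Realizes u.nodes q) : D.Realizes v.nodes q := by
  have hv := v.isChain
  obtain ⟨l, r, i, hu, hv' | ⟨j, hv'⟩⟩ := huv <;> rw [hv'] <;> rw [hv'] at hv <;> rw [hu] at h <;>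
    simp only [List.append_assoc, List.cons_append, List.nil_append] at h hv ⊢ <;>
    refine Realizes.append_cons_congr (fun {x q} h => ?_) l h
  · rw [← Path.Homotopic.Quotient.refl_trans q]
    exact .cons (.refl h.source_mem) h
  · obtain ⟨p, hpi, hpj⟩ := exists_mem_inter_of_eq_or_adj
      (List.isChain_cons_cons.1 (List.isChain_split.1 hv).2).1
    obtain ⟨s, hs⟩ := exists_classIn (x := x) (y := ⟨p, D.cell_subset i hpi⟩) (D.convex_cell i)
      (D.cell_subset i) h.source_mem hpi
    have h1 := Realizes.cons hs (.cons (.refl hpj) (h.trans_left hs.symm))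
    simpa [← Path.Homotopic.Quotient.trans_assoc] using h1

lemma exists_realizes_of_isChain : ∀ (L : List ι) (i : ι) (x : X),
    (i :: L).IsChain (fun i j => i = j ∨ D.topologyGraph.Adj i j) → (i :: L).getLast? = some b →
    (x : Plane) ∈ D.cell i → (y : Plane) ∈ D.cell b → ∃ q : Quotient x y, D.Realizes (i :: L) q
  | [], i, x, _, hl, hx, hy => by
    obtain rfl : i = b := by simpa using hl
    obtain ⟨q, hq⟩ := exists_classIn (D.convex_cell i) (D.cell_subset i) hx hy
    exact ⟨q, .single hq⟩
  | j :: L, i, x, hc, hl, hx, hy => by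
    obtain ⟨hij, hc⟩ := List.isChain_cons_cons.1 hc
    obtain ⟨p, hpi, hpj⟩ := exists_mem_inter_of_eq_or_adj hij
    obtain ⟨q, hq⟩ := exists_realizes_of_isChain L j ⟨p, D.cell_subset i hpi⟩ hc
      (by simpa [List.getLast?_cons_cons] using hl) hpj hy
    obtain ⟨s, hs⟩ := exists_classIn (y := ⟨p, D.cell_subset i hpi⟩) (D.convex_cell i)
      (D.cell_subset i) hx hpi
    exact ⟨_, .cons hs hq⟩

lemma exists_realizes (u : TopoPath D.topologyGraph a b) (hx : (x : Plane) ∈ D.cell a)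
    (hy : (y : Plane) ∈ D.cell b) : ∃ q : Quotient x y, D.Realizes u.nodes q := by
  obtain ⟨L, hL⟩ := u.exists_nodes_eq_cons
  have hc := u.isChain
  have hl := u.last_eq
  rw [hL] at hc hl ⊢
  exact exists_realizes_of_isChain L a x hc hl hx hy

/-- Homotopic paths in the topology graph are passed by the same homotopy classes in `X`. -/
lemma Realizes.of_homotopic {u v : TopoPath D.topologyGraph a b} (huv : u.Homotopic v)
    (hx : (x : Plane) ∈ D.cell a) (hy : (y : Plane) ∈ D.cell b) {q : Quotient x y}
    (h : D.Realizes u.nodes q) : D.Realizes v.nodes q := by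
  induction huv with
  | refl => exact h
  | @tail v w _ hvw ih =>
    rcases hvw with hvw | hwv
    · exact ih.of_extension hvw
    · obtain ⟨q', hq'⟩ := exists_realizes w hx hy
      rwa [ih.unique (hq'.of_extension hwv)]

/-! ### Paths in the plane and the cells that they pass -/

variable {x₀ x₁ x₂ : X} {f : Path x₀ x₁} {s t m : unitInterval}

variable (D) in
/-- The path `f` passes the cells of the list in order during the time from `s` to `t`. -/
inductive Traverses (f : Path x₀ x₁) : List ι → unitInterval → unitInterval → Prop
  | single {i : ι} {s t : unitInterval} : s ≤ t → (∀ r ∈ Icc s t, (f r : Plane) ∈ D.cell i) →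
      Traverses f [i] s t
  | cons {i : ι} {L : List ι} {s m t : unitInterval} : s ≤ m →
      (∀ r ∈ Icc s m, (f r : Plane) ∈ D.cell i) → Traverses f L m t → Traverses f (i :: L) s t

lemma Traverses.append (h : D.Traverses f L s m) (h' : D.Traverses f L' m t) :
    D.Traverses f (L ++ L') s t := by
  induction h with
  | single hs hi => exact .cons hs hi h'
  | cons hs hi _ ih => exact .cons hs hi (ih h')

lemma traverses_of_times : ∀ (L : List ι) (i : ι) (t : ℕ → unitInterval), Monotone t →
    (∀ (k : ℕ) (hk : k < (i :: L).length), ∀ s ∈ Icc (t k) (t (k + 1)),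
      (f s : Plane) ∈ D.cell (i :: L)[k]) → D.Traverses f (i :: L) (t 0) (t (i :: L).length)
  | [], _, t, ht, h => .single (ht zero_le_one) (h 0 (by simp))
  | j :: L, _, t, ht, h => .cons (ht zero_le_one) (h 0 (by simp))
      (traverses_of_times L j (fun k => t (k + 1)) (fun _ _ hkl => ht (by omega))
        fun k hk => h (k + 1) (by simpa using hk))

lemma Traverses.exists_times (h : D.Traverses f L s m) :
    ∃ t : ℕ → unitInterval, Monotone t ∧ t 0 = s ∧ t L.length = m ∧
      ∀ (k : ℕ) (hk : k < L.length), ∀ r ∈ Icc (t k) (t (k + 1)), (f r : Plane) ∈ D.cell L[k] := by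
  induction h with
  | @single i s m hs hi =>
    refine ⟨fun k => k.casesOn s fun _ => m, monotone_nat_of_le_succ fun k => ?_, rfl, rfl, ?_⟩
    · cases k
      · exact hs
      · exact le_rfl
    · intro k hk
      obtain rfl : k = 0 := by simpa using hk
      exact hi
  | @cons i L s m _ hs hi _ ih =>
    obtain ⟨t, ht, rfl, rfl, h⟩ := ih
    refine ⟨fun k => k.casesOn s t, monotone_nat_of_le_succ fun k => ?_, rfl, rfl, ?_⟩
    · cases k
      · exact hs
      · exact ht (Nat.le_succ _)
    · intro k hk
      cases k with
      | zero => exact hi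
      | succ k => exact h k (by simpa using hk)

lemma mem_Gamma_iff {u : TopoPath D.topologyGraph a b} :
    u ∈ D.Gamma f a b ↔ D.Traverses f u.nodes 0 1 := by
  constructor
  · rintro ⟨t, ht, h0, h1, h⟩
    rw [← h0, ← h1]
    obtain ⟨L, hL⟩ := u.exists_nodes_eq_cons
    rw! [hL] at h ⊢
    exact traverses_of_times L a t ht h
  · intro h
    exact h.exists_times

lemma traverses_const {p : Plane} (hp : (f t : Plane) = p) :
    ∀ L : List ι, L ≠ [] → (∀ i ∈ L, p ∈ D.cell i) → D.Traverses f L t t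
  | [], h, _ => (h rfl).elim
  | [i], _, h => .single le_rfl fun r hr => by
      obtain rfl : r = t := by simpa using hr
      exact hp ▸ h i (by simp)
  | i :: j :: L, _, h => .cons le_rfl
      (fun r hr => by
        obtain rfl : r = t := by simpa using hr
        exact hp ▸ h i (by simp))
      (traverses_const hp (j :: L) (by simp) fun k hk => h k (List.mem_cons_of_mem _ hk))

lemma mk_subpath_trans (f : Path x₀ x₁) (s m t : unitInterval) :
    (Path.Homotopic.Quotient.mk (f.subpath s m)).trans
        (Path.Homotopic.Quotient.mk (f.subpath m t)) =
      Path.Homotopic.Quotient.mk (f.subpath s t) :=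
  Path.Homotopic.Quotient.eq.2 ⟨Path.Homotopy.subpathTransSubpath f s m t⟩

lemma classIn_subpath {S : Set Plane} (hst : s ≤ t) (h : ∀ r ∈ Icc s t, (f r : Plane) ∈ S) :
    ClassIn S (Path.Homotopic.Quotient.mk (f.subpath s t)) := by
  refine ⟨_, fun r => ?_, rfl⟩
  have := mem_range_self (f := f.subpath s t) r
  rw [Path.range_subpath_of_le f s t hst] at this
  obtain ⟨r', hr', he⟩ := this
  exact he ▸ h r' hr'

lemma Traverses.realizes_subpath (h : D.Traverses f L s t) :
    D.Realizes L (Path.Homotopic.Quotient.mk (f.subpath s t)) := by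
  induction h with
  | single hs hi => exact .single (classIn_subpath hs hi)
  | cons hs hi _ ih =>
    rw [← mk_subpath_trans]
    exact .cons (classIn_subpath hs hi) ih

lemma realizes_subpath_zero_one :
    D.Realizes L (Path.Homotopic.Quotient.mk (f.subpath 0 1)) ↔
      D.Realizes L (Path.Homotopic.Quotient.mk f) := by
  have key {x y x' y' : X} (q : Quotient x y) (hx : x' = x) (hy : y' = y) :
      D.Realizes L (q.cast hx hy) ↔ D.Realizes L q := by
    subst hx hy
    simp
  rw [Path.subpath_zero_one, Path.Homotopic.Quotient.mk_cast, key]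

lemma realizes_of_mem_Gamma {u : TopoPath D.topologyGraph a b} (h : u ∈ D.Gamma f a b) :
    D.Realizes u.nodes (Path.Homotopic.Quotient.mk f) :=
  realizes_subpath_zero_one.1 (mem_Gamma_iff.1 h).realizes_subpath

/-- The time of the concatenation of two paths at which the second one is at time `t`. -/
noncomputable def secondHalf (t : unitInterval) : unitInterval :=
  ⟨(1 + t) / 2, by constructor <;> linarith [t.2.1, t.2.2]⟩

lemma trans_secondHalf (g : Path x₀ x₁) (f : Path x₁ x₂) (t : unitInterval) :
    g.trans f (secondHalf t) = f t := by
  rw [Path.trans_apply]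
  split_ifs with h
  · have h0 : t = 0 := by
      ext
      simp only [secondHalf] at h
      have := t.2.1
      rw [Icc.coe_zero]
      linarith
    subst h0
    have : (⟨2 * (secondHalf 0 : ℝ), (unitInterval.mul_pos_mem_iff zero_lt_two).2
        ⟨(secondHalf 0).2.1, h⟩⟩ : unitInterval) = 1 := by
      ext; simp [secondHalf]
    rw [this]
    simp
  · congr 1
    ext
    simp [secondHalf]
    ring

lemma Traverses.trans_left {f : Path x₁ x₂} (g : Path x₀ x₁) (h : D.Traverses f L s t) :
    D.Traverses (g.trans f) L (secondHalf s) (secondHalf t) := by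
  have key {i : ι} {s t : unitInterval} (h : ∀ r ∈ Icc s t, (f r : Plane) ∈ D.cell i) :
      ∀ r ∈ Icc (secondHalf s) (secondHalf t), (g.trans f r : Plane) ∈ D.cell i := by
    rintro r ⟨hr1, hr2⟩
    have h1 : (1 + s : ℝ) / 2 ≤ r := hr1
    have h2 : (r : ℝ) ≤ (1 + t) / 2 := hr2
    have h3 := s.2.1
    have h4 := t.2.2
    obtain ⟨r', hr'⟩ : ∃ r' : unitInterval, (r' : ℝ) = 2 * r - 1 :=
      ⟨⟨2 * r - 1, by constructor <;> linarith⟩, rfl⟩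
    have : r = secondHalf r' := by ext; simp [secondHalf, hr']
    rw [this, trans_secondHalf]
    refine h r' ⟨?_, ?_⟩
    · rw [← Subtype.coe_le_coe, hr']; linarith
    · rw [← Subtype.coe_le_coe, hr']; linarith
  have mono {s t : unitInterval} (h : s ≤ t) : secondHalf s ≤ secondHalf t := by
    rw [← Subtype.coe_le_coe] at h ⊢
    simp only [secondHalf]
    linarith
  induction h with
  | single hs hi => exact .single (mono hs) (key hi)
  | cons hs hi _ ih => exact .cons (mono hs) (key hi) ih

lemma Realizes.exists_traverses {q : Quotient x y} (h : D.Realizes L q) :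
    ∃ f : Path x y, Path.Homotopic.Quotient.mk f = q ∧ D.Traverses f L 0 1 := by
  induction h with
  | single h =>
    obtain ⟨f, hf, hq⟩ := h
    exact ⟨f, hq, .single zero_le_one fun r _ => hf r⟩
  | cons h _ ih =>
    obtain ⟨g, hg, rfl⟩ := h
    obtain ⟨f, rfl, hf⟩ := ih
    refine ⟨g.trans f, rfl, ?_⟩
    have h1 : (secondHalf 1) = 1 := by ext; simp [secondHalf]
    rw [← h1]
    refine .cons (m := secondHalf 0) (unitInterval.nonneg _) (fun r hr => ?_) (hf.trans_left g)
    have hr' : (r : ℝ) ≤ 1 / 2 := by simpa [secondHalf] using Subtype.coe_le_coe.2 hr.2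
    rw [Path.trans_apply, dif_pos hr']
    exact hg _

/-! ### Subdivision of paths -/

/-- A transitive relation between times holds from start to end if it holds locally. -/
lemma unitInterval_induction {Q : unitInterval → unitInterval → Prop}
    (trans : ∀ s m t, s ≤ m → m ≤ t → Q s m → Q m t → Q s t)
    (loc : ∀ t₀, ∃ N ∈ 𝓝 t₀, ∀ s ∈ N, ∀ t ∈ N, s ≤ t → Q s t) : Q 0 1 := by
  choose N hN hQ using loc
  obtain ⟨t, h0, ht, ⟨n, hn⟩, hsub⟩ := exists_monotone_Icc_subset_open_cover_unitInterval
    (c := fun t => interior (N t)) (fun _ => isOpen_interior)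
    fun t _ => mem_iUnion.2 ⟨t, mem_interior_iff_mem_nhds.2 (hN t)⟩
  have hstep (k : ℕ) : Q (t k) (t (k + 1)) := by
    obtain ⟨i, hi⟩ := hsub k
    have hk := ht k.le_succ
    exact hQ i _ (interior_subset (hi ⟨le_rfl, hk⟩)) _ (interior_subset (hi ⟨hk, le_rfl⟩)) hk
  have hk (k : ℕ) : Q (t 0) (t (k + 1)) := by
    induction k with
    | zero => exact hstep 0
    | succ k ih => exact trans _ _ _ (ht (Nat.zero_le _)) (ht (Nat.le_succ _)) ih (hstep _)
  simpa [h0, hn (n + 1) n.le_succ] using hk n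

lemma exists_topoPath_of_reflTransGen {p : Plane} (hi : p ∈ D.cell i)
    (h : Relation.ReflTransGen (D.AdjAt p) i j) :
    ∃ u : TopoPath D.topologyGraph i j, ∀ k ∈ u.nodes, p ∈ D.cell k := by
  induction h with
  | refl => exact ⟨.single i, by simpa [TopoPath.single] using hi⟩
  | @tail k l _ hkl ih =>
    obtain ⟨u, hu⟩ := ih
    refine ⟨u.append (.edge hkl.1), fun m hm => ?_⟩
    have hm' : m ∈ u.nodes ∨ m = k ∨ m = l := by
      simpa [TopoPath.append, TopoPath.edge] using hm
    rcases hm' with hm | rfl | rfl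
    exacts [hu m hm, hkl.2.1, hkl.2.2]

lemma Gamma_nonempty_of_changesFinitelyOften [Finite ι] (hX : NoPinchPoint X)
    (hf : D.ChangesFinitelyOften f) (ha : (x₀ : Plane) ∈ D.cell a)
    (hb : (x₁ : Plane) ∈ D.cell b) : (D.Gamma f a b).Nonempty := by
  have conn (t : unitInterval) {i j : ι} (hi : (f t : Plane) ∈ D.cell i)
      (hj : (f t : Plane) ∈ D.cell j) :
      ∃ u : TopoPath D.topologyGraph i j, D.Traverses f u.nodes t t := by
    obtain ⟨u, hu⟩ := exists_topoPath_of_reflTransGen hi (D.reflTransGen_adjAt hX hi hj)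
    exact ⟨u, traverses_const rfl _ u.nodes_ne_nil hu⟩
  suffices h : ∀ i j, (f 0 : Plane) ∈ D.cell i → (f 1 : Plane) ∈ D.cell j →
      ∃ u : TopoPath D.topologyGraph i j, D.Traverses f u.nodes 0 1 by
    obtain ⟨u, hu⟩ := h a b (by simpa) (by simpa)
    exact ⟨u, mem_Gamma_iff.2 hu⟩
  refine unitInterval_induction (Q := fun s t => ∀ i j, (f s : Plane) ∈ D.cell i →
    (f t : Plane) ∈ D.cell j → ∃ u : TopoPath D.topologyGraph i j, D.Traverses f u.nodes s t)
    ?_ fun t₀ => ?_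
  · intro s m t _ _ h1 h2 i j hi hj
    obtain ⟨k, hk⟩ := D.exists_mem_cell (f m).2
    obtain ⟨u, hu⟩ := h1 i k hi hk
    obtain ⟨v, hv⟩ := h2 k j hk hj
    exact ⟨u.append v, hu.append hv⟩
  obtain ⟨T, hT⟩ := hf
  have hTN : ((T : Set unitInterval) \ {t₀})ᶜ ∈ 𝓝 t₀ :=
    ((T.finite_toSet.subset sdiff_subset).isClosed.isOpen_compl).mem_nhds (by simp)
  obtain ⟨c, d, ht₀, hN, hsub⟩ := exists_Icc_mem_subset_of_mem_nhds hTN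
  have hnot (r : unitInterval) (h1 : r ∈ Icc c d) (h2 : r ≠ t₀) : r ∉ T := fun h =>
    hsub h1 ⟨h, h2⟩
  have hcont : Continuous fun r => (f r : Plane) := by fun_prop
  -- off `t₀` the cells do not change, and cells are closed
  have right (t : unitInterval) (ht : t ∈ Icc c d) (h : t₀ ≤ t) (j : ι)
      (hj : (f t : Plane) ∈ D.cell j) : ∀ r ∈ Icc t₀ t, (f r : Plane) ∈ D.cell j := by
    rcases h.eq_or_lt with rfl | hlt
    · intro r hr
      obtain rfl : r = t₀ := by simpa using hr
      exact hj
    have : Ioc t₀ t ⊆ {r | (f r : Plane) ∈ D.cell j} := fun r hr =>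
      (hT r t (fun w hw => by
        rw [uIcc_of_le hr.2] at hw
        exact hnot w ⟨ht₀.1.trans (hr.1.le.trans hw.1), hw.2.trans ht.2⟩
          (hr.1.trans_le hw.1).ne') j).2 hj
    have hcl := ((D.isClosed_cell j).preimage hcont).closure_subset_iff.2 this
    rwa [closure_Ioc hlt.ne] at hcl
  have left (s : unitInterval) (hs : s ∈ Icc c d) (h : s ≤ t₀) (i : ι)
      (hi : (f s : Plane) ∈ D.cell i) : ∀ r ∈ Icc s t₀, (f r : Plane) ∈ D.cell i := by
    rcases h.eq_or_lt with rfl | hlt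
    · intro r hr
      obtain rfl : r = s := by simpa using hr
      exact hi
    have : Ico s t₀ ⊆ {r | (f r : Plane) ∈ D.cell i} := fun r hr =>
      (hT s r (fun w hw => by
        rw [uIcc_of_le hr.1] at hw
        exact hnot w ⟨hs.1.trans hw.1, hw.2.trans (hr.2.le.trans ht₀.2)⟩
          (hw.2.trans_lt hr.2).ne) i).1 hi
    have hcl := ((D.isClosed_cell i).preimage hcont).closure_subset_iff.2 this
    rwa [closure_Ico hlt.ne] at hcl
  refine ⟨_, hN, fun s hs t ht hst i j hi hj => ?_⟩
  rcases le_total t t₀ with h1 | h1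
  · have hL := left s hs (hst.trans h1) i hi
    obtain ⟨u, hu⟩ := conn t (hL t ⟨hst, h1⟩) hj
    exact ⟨(TopoPath.single i).append u,
      Traverses.append (.single hst fun r hr => hL r ⟨hr.1, hr.2.trans h1⟩) hu⟩
  rcases le_total t₀ s with h2 | h2
  · have hR := right t ht h1 j hj
    obtain ⟨u, hu⟩ := conn s hi (hR s ⟨h2, hst⟩)
    exact ⟨u.append (.single j), hu.append (.single hst fun r hr => hR r ⟨h2.trans hr.1, hr.2⟩)⟩
  · have hL := left s hs h2 i hi
    have hR := right t ht h1 j hj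
    obtain ⟨u, hu⟩ := conn t₀ (hL t₀ ⟨h2, le_rfl⟩) (hR t₀ ⟨le_rfl, h1⟩)
    exact ⟨(TopoPath.single i).append (u.append (.single j)),
      Traverses.append (.single h2 hL) (hu.append (.single h1 hR))⟩

lemma realizes_const {p : X} : ∀ L : List ι, L ≠ [] → (∀ i ∈ L, (p : Plane) ∈ D.cell i) →
    D.Realizes L (Quotient.refl p)
  | [], h, _ => (h rfl).elim
  | [i], _, h => .single (.refl (h i (by simp)))
  | i :: j :: L, _, h => by
    rw [← Path.Homotopic.Quotient.refl_trans (Quotient.refl p)]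
    exact .cons (.refl (h i (by simp)))
      (realizes_const (j :: L) (by simp) fun k hk => h k (List.mem_cons_of_mem _ hk))

/-- Every homotopy class passes some sequence of cells: near a point `p` of the path, the path can
be replaced by two segments that meet in `p`. -/
lemma exists_realizes_mk [Finite ι] (hX : NoPinchPoint X) (f : Path x₀ x₁)
    (ha : (x₀ : Plane) ∈ D.cell a) (hb : (x₁ : Plane) ∈ D.cell b) :
    ∃ u : TopoPath D.topologyGraph a b, D.Realizes u.nodes (Path.Homotopic.Quotient.mk f) := by
  suffices h : ∀ i j, (f 0 : Plane) ∈ D.cell i → (f 1 : Plane) ∈ D.cell j →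
      ∃ u : TopoPath D.topologyGraph i j,
        D.Realizes u.nodes (Path.Homotopic.Quotient.mk (f.subpath 0 1)) by
    obtain ⟨u, hu⟩ := h a b (by simpa) (by simpa)
    exact ⟨u, realizes_subpath_zero_one.1 hu⟩
  refine unitInterval_induction (Q := fun s t => ∀ i j, (f s : Plane) ∈ D.cell i →
    (f t : Plane) ∈ D.cell j → ∃ u : TopoPath D.topologyGraph i j,
      D.Realizes u.nodes (Path.Homotopic.Quotient.mk (f.subpath s t))) ?_ fun t₀ => ?_
  · intro s m t _ _ h1 h2 i j hi hj
    obtain ⟨k, hk⟩ := D.exists_mem_cell (f m).2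
    obtain ⟨u, hu⟩ := h1 i k hi hk
    obtain ⟨v, hv⟩ := h2 k j hk hj
    rw [← mk_subpath_trans f s m t]
    exact ⟨u.append v, hu.append hv⟩
  set p := f t₀ with hp
  obtain ⟨r, hr, hball⟩ := Metric.mem_nhds_iff.1
    ((D.isOpen_setOf_forall_mem_cell p).mem_nhds fun _ h => h)
  have hcont : Continuous fun r => (f r : Plane) := by fun_prop
  obtain ⟨c, d, -, hN, hsub⟩ := exists_Icc_mem_subset_of_mem_nhds
    (hcont.continuousAt.preimage_mem_nhds (x := t₀) (Metric.ball_mem_nhds _ hr))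
  have hstar : StarConvex ℝ (p : Plane) (Metric.ball (p : Plane) r ∩ X) := by
    rw [starConvex_iff_segment_subset]
    intro y hy
    obtain ⟨k, hk⟩ := D.exists_mem_cell hy.2
    have hpk := hball hy.1 k hk
    exact subset_inter ((convex_ball _ _).segment_subset (Metric.mem_ball_self hr) hy.1)
      (((D.convex_cell k).segment_subset hpk hk).trans (D.cell_subset k))
  refine ⟨_, hN, fun s hs t ht hst i j hi hj => ?_⟩
  have hpi := hball (hsub hs) i hi
  have hpj := hball (hsub ht) j hj
  have hsubX (k : ι) : Metric.ball (p : Plane) r ∩ D.cell k ⊆ X :=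
    inter_subset_right.trans (D.cell_subset k)
  obtain ⟨q₁, hq₁⟩ := exists_classIn ((convex_ball (p : Plane) r).inter (D.convex_cell i))
    (hsubX i) ⟨hsub hs, hi⟩ ⟨Metric.mem_ball_self hr, hpi⟩
  obtain ⟨q₂, hq₂⟩ := exists_classIn ((convex_ball (p : Plane) r).inter (D.convex_cell j))
    (hsubX j) ⟨Metric.mem_ball_self hr, hpj⟩ ⟨hsub ht, hj⟩
  have hq : q₁.trans q₂ = Path.Homotopic.Quotient.mk (f.subpath s t) :=
    ((hq₁.mono (inter_subset_inter_right _ (D.cell_subset i))).trans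
      (hq₂.mono (inter_subset_inter_right _ (D.cell_subset j)))).eq_of_starConvex hstar
      inter_subset_right (classIn_subpath hst fun w hw =>
        ⟨hsub ⟨hs.1.trans hw.1, hw.2.trans ht.2⟩, (f w).2⟩)
  obtain ⟨u, hu⟩ := exists_topoPath_of_reflTransGen hpi (D.reflTransGen_adjAt hX hpi hpj)
  refine ⟨(TopoPath.single i).append (u.append (.single j)), ?_⟩
  rw [← hq, ← Path.Homotopic.Quotient.refl_trans q₂]
  exact Realizes.append (.single (hq₁.mono inter_subset_right))
    ((realizes_const _ u.nodes_ne_nil hu).append (.single (hq₂.mono inter_subset_right)))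

end ConvexDissection

namespace ConvexDissection

/-! ### The covering space of holonomy values -/

section Covering

/-- The group of holonomy values carries the discrete topology, as the fibre of a covering. -/
instance {V : Type*} : TopologicalSpace (FreeGroup (V × V)) := ⊥

instance {V : Type*} : DiscreteTopology (FreeGroup (V × V)) := ⟨rfl⟩

variable {X : Set Plane} {ι : Type*} [Finite ι] (D : ConvexDissection X ι)

/-- A function on the cells at `x` whose differences are the steps between these cells. -/
noncomputable def potential (x : Plane) : ι → FreeGroup (ι × ι) := (D.exists_potential x).choose

lemma potential_of_adjAt {x : Plane} {i j : ι} (h : D.AdjAt x i j) :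
    D.potential x j = D.potential x i * step i j :=
  (D.exists_potential x).choose_spec i j h

/-- Two potentials differ by a constant on the cells at a common nearby point. -/
lemma potential_mul_inv_eq (hX : NoPinchPoint X) {x y z : Plane} {i j : ι}
    (hx : ∀ k, z ∈ D.cell k → x ∈ D.cell k) (hy : ∀ k, z ∈ D.cell k → y ∈ D.cell k)
    (hi : z ∈ D.cell i) (hj : z ∈ D.cell j) :
    D.potential x i * (D.potential y i)⁻¹ = D.potential x j * (D.potential y j)⁻¹ := by
  induction D.reflTransGen_adjAt hX hi hj with
  | refl => rfl
  | @tail k l _ hkl ih =>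
    rw [ih hkl.2.1, D.potential_of_adjAt ⟨hkl.1, hx _ hkl.2.1, hx _ hkl.2.2⟩,
      D.potential_of_adjAt ⟨hkl.1, hy _ hkl.2.1, hy _ hkl.2.2⟩]
    group

/-- The covering of `X` whose fibre over `z` consists of the functions on the cells at `z` with
differences given by the steps. In the chart around `x` such a function is `v * potential x` for an
element `v` of the group, which is its coordinate. -/
noncomputable def holonomyCover (hX : NoPinchPoint X) :
    FiberBundleCore X X (FreeGroup (ι × ι)) where
  baseSet x := {y | ∀ i, (y : Plane) ∈ D.cell i → (x : Plane) ∈ D.cell i}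
  isOpen_baseSet x := (D.isOpen_setOf_forall_mem_cell x).preimage continuous_subtype_val
  indexAt := id
  mem_baseSet_at _ := fun _ h => h
  coordChange x y z v := v * (D.potential x (D.cellAt z) * (D.potential y (D.cellAt z))⁻¹)
  coordChange_self x z _ v := by simp
  continuousOn_coordChange x y := by
    rintro ⟨z, v⟩ ⟨⟨hx, hy⟩, -⟩
    refine ContinuousAt.continuousWithinAt ?_
    have hU : {w : X | ∀ i, (w : Plane) ∈ D.cell i → (z : Plane) ∈ D.cell i} ∈ 𝓝 z :=
      ((D.isOpen_setOf_forall_mem_cell z).preimage continuous_subtype_val).mem_nhds fun _ h => h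
    have hev : (fun p : X × FreeGroup (ι × ι) => p.2 * (D.potential x (D.cellAt z) *
        (D.potential y (D.cellAt z))⁻¹)) =ᶠ[𝓝 (z, v)] fun p => p.2 * (D.potential x (D.cellAt p.1) *
        (D.potential y (D.cellAt p.1))⁻¹) := by
      filter_upwards [continuous_fst.continuousAt.preimage_mem_nhds hU] with p hp
      rw [D.potential_mul_inv_eq hX hx hy (D.mem_cellAt z) (hp _ (D.mem_cellAt p.1))]
    refine ContinuousAt.congr ?_ hev
    exact (continuous_of_discreteTopology (f := fun w : FreeGroup (ι × ι) => w *
      (D.potential x (D.cellAt z) * (D.potential y (D.cellAt z))⁻¹))).continuousAt.comp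
      continuous_snd.continuousAt
  coordChange_comp x y w z _ v := by group

variable (hX : NoPinchPoint X)

/-- The value at the cell `k` of a point of the covering, viewed as a function on the cells. -/
noncomputable def coverValue (e : (D.holonomyCover hX).TotalSpace) (k : ι) : FreeGroup (ι × ι) :=
  (show FreeGroup (ι × ι) from e.2) * D.potential e.1 k

lemma isCoveringMap_proj : IsCoveringMap (D.holonomyCover hX).proj :=
  FiberBundle.isCoveringMap (F := FreeGroup (ι × ι)) (E := (D.holonomyCover hX).Fiber)

lemma coverValue_of_eq_or_adj {e : (D.holonomyCover hX).TotalSpace} {i j : ι}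
    (h : i = j ∨ D.topologyGraph.Adj i j) (hi : (e.1 : Plane) ∈ D.cell i)
    (hj : (e.1 : Plane) ∈ D.cell j) :
    D.coverValue hX e j = D.coverValue hX e i * step i j := by
  rcases h with rfl | h
  · simp
  · rw [coverValue, coverValue, D.potential_of_adjAt ⟨h, hi, hj⟩, mul_assoc]

/-- While a path in the covering stays over the cell `k`, its value at `k` does not change. -/
lemma coverValue_eq_of_forall_mem (γ : C(unitInterval, (D.holonomyCover hX).TotalSpace)) {k : ι}
    (hγ : ∀ t, ((γ t).1 : Plane) ∈ D.cell k) (s t : unitInterval) :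
    D.coverValue hX (γ s) k = D.coverValue hX (γ t) k := by
  suffices h : IsLocallyConstant fun t => D.coverValue hX (γ t) k from
    h.apply_eq_of_preconnectedSpace s t
  rw [IsLocallyConstant.iff_eventually_eq]
  intro t₀
  set x := (γ t₀).1 with hx
  set T := (D.holonomyCover hX).localTriv x
  have hsrc : γ t₀ ∈ T.source := (D.holonomyCover hX).mem_localTrivAt_source _ _ |>.2 fun _ h => h
  have hT : ContinuousAt (fun t => (T (γ t)).2) t₀ :=
    continuous_snd.continuousAt.comp
      ((T.continuousOn.continuousAt (T.open_source.mem_nhds hsrc)).comp γ.continuous.continuousAt)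
  have e1 : ∀ᶠ t in 𝓝 t₀, (T (γ t)).2 = (T (γ t₀)).2 := by
    simpa using hT.eventually (p := fun v => v = (T (γ t₀)).2) (by simp [nhds_discrete])
  have e2 : ∀ᶠ t in 𝓝 t₀, γ t ∈ T.source :=
    γ.continuous.continuousAt.eventually (T.open_source.mem_nhds hsrc)
  have key (t : unitInterval) (ht : γ t ∈ T.source) :
      D.coverValue hX (γ t) k = (T (γ t)).2 * D.potential x k := by
    have hU : ∀ i, ((γ t).1 : Plane) ∈ D.cell i → (x : Plane) ∈ D.cell i :=
      ((D.holonomyCover hX).mem_localTrivAt_source _ _).1 ht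
    obtain ⟨v, hv⟩ : ∃ v : FreeGroup (ι × ι), v = (γ t).2 := ⟨_, rfl⟩
    have h1 : (T (γ t)).2 =
        v * (D.potential (γ t).1 (D.cellAt (γ t).1) * (D.potential x (D.cellAt (γ t).1))⁻¹) := by
      rw [hv]; rfl
    have h2 : D.coverValue hX (γ t) k = v * D.potential (γ t).1 k := by rw [hv]; rfl
    rw [h2, h1, D.potential_mul_inv_eq hX (fun _ h => h) hU (D.mem_cellAt _) (hγ t)]
    group
  filter_upwards [e1, e2] with t h1 h2
  rw [key t h2, h1, ← key t₀ hsrc]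

lemma coverValue_monodromy_of_classIn {x y : X} {q : Path.Homotopic.Quotient x y} {k : ι}
    (hq : ClassIn (D.cell k) q) (e : (D.holonomyCover hX).proj ⁻¹' {x}) :
    D.coverValue hX ((D.isCoveringMap_proj hX).monodromy q e) k = D.coverValue hX e k := by
  obtain ⟨f, hf, rfl⟩ := hq
  have h0 : (f : C(unitInterval, X)) 0 = (D.holonomyCover hX).proj e := f.source.trans e.2.symm
  set γ := (D.isCoveringMap_proj hX).liftPath f e h0
  have hγ (t : unitInterval) : ((γ t).1 : Plane) ∈ D.cell k := by
    have : (γ t).1 = f t := congr_fun ((D.isCoveringMap_proj hX).liftPath_lifts f e h0) t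
    rw [this]
    exact hf t
  have h1 : γ 0 = e := (D.isCoveringMap_proj hX).liftPath_zero f e h0
  rw [← h1]
  exact D.coverValue_eq_of_forall_mem hX γ hγ 1 0

variable {D} in
/-- The monodromy of a class that passes the given cells multiplies values by their holonomy. -/
lemma Realizes.coverValue_monodromy {b : ι} : ∀ {L : List ι} {i : ι} {x y : X}
    {q : Path.Homotopic.Quotient x y}, D.Realizes (i :: L) q →
    (i :: L).IsChain (fun i j => i = j ∨ D.topologyGraph.Adj i j) → (i :: L).getLast? = some b →
    ∀ e : (D.holonomyCover hX).proj ⁻¹' {x},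
      D.coverValue hX ((D.isCoveringMap_proj hX).monodromy q e) b =
        D.coverValue hX e i * holonomy (i :: L)
  | [], i, _, _, _, hq, _, hl, e => by
    obtain rfl : i = b := by simpa using hl
    simpa [holonomy] using D.coverValue_monodromy_of_classIn hX hq.single_inv e
  | j :: L, i, x, _, _, hq, hc, hl, e => by
    obtain ⟨hij, hc⟩ := List.isChain_cons_cons.1 hc
    obtain ⟨y, p, r, hp, hr, rfl⟩ := hq.cons_inv
    have he : ((D.isCoveringMap_proj hX).monodromy p e).1.1 = y :=
      ((D.isCoveringMap_proj hX).monodromy p e).2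
    rw [IsCoveringMap.monodromy_trans_apply, hr.coverValue_monodromy hc
      (by simpa [List.getLast?_cons_cons] using hl), D.coverValue_of_eq_or_adj hX hij
      (he.symm ▸ hp.symm.source_mem) (he.symm ▸ hr.source_mem),
      D.coverValue_monodromy_of_classIn hX hp, holonomy, mul_assoc]

end Covering

variable {X : Set Plane} {ι : Type*} [Finite ι] {D : ConvexDissection X ι} {a b : ι} {x y : X}

/-- The class determines the holonomy, hence the homotopy class in the topology graph, of the cells
that it passes. -/
lemma Realizes.homotopic (hX : NoPinchPoint X) {q : Path.Homotopic.Quotient x y}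
    {u v : TopoPath D.topologyGraph a b} (hu : D.Realizes u.nodes q)
    (hv : D.Realizes v.nodes q) : u.Homotopic v := by
  rw [TopoPath.homotopic_iff_holonomy_eq]
  have e : (D.holonomyCover hX).proj ⁻¹' {x} := ⟨⟨x, (1 : FreeGroup (ι × ι))⟩, rfl⟩
  have key {u : TopoPath D.topologyGraph a b} (hu : D.Realizes u.nodes q) :
      D.coverValue hX ((D.isCoveringMap_proj hX).monodromy q e) b =
        D.coverValue hX e a * holonomy u.nodes := by
    obtain ⟨L, hL⟩ := u.exists_nodes_eq_cons
    have hc := u.isChain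
    have hl := u.last_eq
    rw [hL] at hu hc hl ⊢
    exact hu.coverValue_monodromy hX hc hl e
  exact mul_left_cancel ((key hu).symm.trans (key hv))

/-- Homotopy classes in `X` and in the topology graph determine each other. -/
theorem eq_iff_homotopic_of_realizes (hX : NoPinchPoint X) (hx : (x : Plane) ∈ D.cell a)
    (hy : (y : Plane) ∈ D.cell b) {q q' : Path.Homotopic.Quotient x y}
    {u v : TopoPath D.topologyGraph a b} (hu : D.Realizes u.nodes q)
    (hv : D.Realizes v.nodes q') : q = q' ↔ u.Homotopic v := by
  constructor
  · rintro rfl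
    exact Realizes.homotopic hX hu hv
  · intro huv
    exact (hu.of_homotopic huv hx hy).unique hv

end ConvexDissection

end ConvexDissectionTopology

theorem mainTheorem1 {X : Set ConvexDissectionTopology.Plane} {ι : Type*} [Finite ι]
    (hX : ConvexDissectionTopology.NoPinchPoint X)
    (D : ConvexDissectionTopology.ConvexDissection X ι)
    (x₀ x₁ : X) (a b : ι)
    (ha : (x₀ : ConvexDissectionTopology.Plane) ∈ D.cell a)
    (hb : (x₁ : ConvexDissectionTopology.Plane) ∈ D.cell b) :
    -- `Γ(f)` exists for every path that changes cells finitely often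
    (∀ f : Path x₀ x₁, D.ChangesFinitelyOften f → (D.Gamma f a b).Nonempty) ∧
    -- two paths are homotopic iff their images under `Γ` are
    (∀ f g : Path x₀ x₁, ∀ u ∈ D.Gamma f a b, ∀ v ∈ D.Gamma g a b,
      (f.Homotopic g ↔ u.Homotopic v)) ∧
    -- `Γ*` is well defined on paths
    (∀ f : Path x₀ x₁, (D.Gamma f a b).Nonempty → ∃! w, w ∈ D.GammaStar f a b) ∧
    -- `Γ*` has exactly one value on every homotopy class
    (∀ q : Path.Homotopic.Quotient x₀ x₁, ∃! w, w ∈ D.GammaStarClass q a b) ∧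
    -- `Γ*` separates the homotopy classes
    (∀ q q' : Path.Homotopic.Quotient x₀ x₁,
      D.GammaStarClass q a b = D.GammaStarClass q' a b → q = q') ∧
    -- hence `Γ*` decides homotopy of paths
    (∀ f g : Path x₀ x₁, ∀ w ∈ D.GammaStar f a b, ∀ w' ∈ D.GammaStar g a b,
      (f.Homotopic g ↔ w = w')) := by
  have hΓ (f g : Path x₀ x₁) (u) (hu : u ∈ D.Gamma f a b) (v) (hv : v ∈ D.Gamma g a b) :
      f.Homotopic g ↔ u.Homotopic v := by
    rw [← Path.Homotopic.Quotient.eq]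
    exact ConvexDissectionTopology.ConvexDissection.eq_iff_homotopic_of_realizes hX ha hb
      (ConvexDissectionTopology.ConvexDissection.realizes_of_mem_Gamma hu)
      (ConvexDissectionTopology.ConvexDissection.realizes_of_mem_Gamma hv)
  have hΓs (f g : Path x₀ x₁) (w) (hw : w ∈ D.GammaStar f a b) (w') (hw' : w' ∈ D.GammaStar g a b) :
      f.Homotopic g ↔ w = w' := by
    obtain ⟨hw, u, hu, huw⟩ := hw
    obtain ⟨hw', v, hv, hvw⟩ := hw'
    rw [hΓ f g u hu v hv]
    constructor
    · intro huv
      exact hw.eq_of_homotopic hw' (huw.symm.trans (huv.trans hvw))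
    · rintro rfl
      exact huw.trans hvw.symm
  have hex (f : Path x₀ x₁) (h : (D.Gamma f a b).Nonempty) : ∃ w, w ∈ D.GammaStar f a b := by
    obtain ⟨u, hu⟩ := h
    obtain ⟨w, hw, huw⟩ := u.exists_noRollback_homotopic
    exact ⟨w, hw, u, hu, huw⟩
  have hclass (q : Path.Homotopic.Quotient x₀ x₁) : ∃ w, w ∈ D.GammaStarClass q a b := by
    obtain ⟨f, rfl⟩ := Path.Homotopic.Quotient.mk_surjective q
    obtain ⟨u, hu⟩ :=
      ConvexDissectionTopology.ConvexDissection.exists_realizes_mk (D := D) hX f ha hb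
    -- `f` itself may have no image under `Γ`, but it is homotopic to a path `g` that has one
    obtain ⟨g, hg, hgu⟩ := hu.exists_traverses
    obtain ⟨w, hw⟩ :=
      hex g ⟨u, ConvexDissectionTopology.ConvexDissection.mem_Gamma_iff.2 hgu⟩
    exact ⟨w, g, hg, hw⟩
  refine ⟨fun f hf =>
    ConvexDissectionTopology.ConvexDissection.Gamma_nonempty_of_changesFinitelyOften hX hf ha hb,
    hΓ, fun f hf => ?_, fun q => ?_, fun q q' h => ?_, hΓs⟩
  · obtain ⟨w, hw⟩ := hex f hf
    exact ⟨w, hw, fun w' hw' => (hΓs f f w' hw' w hw).1 (.refl f)⟩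
  · obtain ⟨w, hw⟩ := hclass q
    refine ⟨w, hw, fun w' hw' => ?_⟩
    obtain ⟨f, rfl, hf⟩ := hw
    obtain ⟨g, hg, hg'⟩ := hw'
    exact (hΓs g f w' hg' w hf).1 (Path.Homotopic.Quotient.eq.1 hg)
  · obtain ⟨w, hw⟩ := hclass q
    have hw' : w ∈ D.GammaStarClass q' a b := h ▸ hw
    obtain ⟨f, rfl, hf⟩ := hw
    obtain ⟨g, rfl, hg⟩ := hw'
    exact Path.Homotopic.Quotient.eq.2 ((hΓs f g w hf w hg).2 rfl)
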